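/- Let $\omega(s)=\sum_{j,k=1}^{\infty}\bigl(jk(j+k)\bigr)^{-s}$ for $s\in\mathbb{C}$. (1) The double series converges (absolutely) precisely for those $s\in\mathbb{C}$ with $\operatorname{Re}(s)>\tfrac23$, and it defines a holomorphic function in that region. (2) $\omega(s)$ can be analytically continued to a meromorphic function on $\mathbb{C}$, also denoted by $\omega(s)$. (3) $\omega(s)$ has a simple pole at $s=\tfrac23$ with residue $\frac{1}{2\pi\sqrt3}\,\Gamma\left(\tfrac13\right)^3$, and for each $k=0,1,2,\ldots$ it has a simple pole at $s=\tfrac12-k$ with residue $(-1)^k2^{-4k}\binom{2k}{k}\zeta\left(\frac{1-6k}{2}\right)$, where $\Gamma$ is the gamma function and $\zeta$ the Riemann zeta function. It has no other singularities. (4) For every closed interval $[a,b]\subset\mathbb{R}$ there exist constants $C,M>0$ such that $|\omega(\sigma+it)|\le C|t|^{M}$ for all $\sigma\in[a,b]$ and all real $t$ with $|t|\ge1$. -/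

import Mathlib

/-- The general term `(j k (j + k))^{-s}`, `j, k ≥ 1`, of the double series; the base is a positive
integer, so the complex power is the usual one. -/
noncomputable def omegaTerm (s : ℂ) (p : ℕ+ × ℕ+) : ℂ :=
  1 / (((p.1 : ℂ) * (p.2 : ℂ) * ((p.1 : ℂ) + (p.2 : ℂ))) ^ s)

/-- The series `ω(s) = ∑_{j, k ≥ 1} (j k (j + k))^{-s}` (meaningful where it converges). -/
noncomputable def omegaSeries (s : ℂ) : ℂ :=
  ∑' p : ℕ+ × ℕ+, omegaTerm s p

/-- `f` has a simple pole at `z₀` with residue `r`: its Laurent expansion at `z₀` has the principal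
part `r / (z - z₀)`, and `r ≠ 0`. -/
def HasSimplePoleWithResidue (f : ℂ → ℂ) (z₀ r : ℂ) : Prop :=
  r ≠ 0 ∧ ∃ g : ℂ → ℂ, AnalyticAt ℂ g z₀ ∧
    ∀ᶠ z in nhdsWithin z₀ {z₀}ᶜ, f z = r / (z - z₀) + g z

/-! Multiply the summand by 1 = (j/(j+k) + k/(j+k))^K with K = 2r + 1 and expand. By the symmetry of
j and k only the terms with i ≤ r are needed, counted twice. Such a term is j^(i-s) k^(K-i-s)
(j+k)^(-K-s), and the high power of k makes it vanish to high order at k = 0. Euler–Maclaurin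
summation in k therefore has no boundary terms. It yields an integral, which is homogeneous in j and
given by a Beta value, and integrals against a periodic Bernoulli function, which are integrated by
parts r times, each time gaining a power of j. Summed over j, the main terms become ζ(3s-1) times
Beta values, and the remainders become a holomorphic function on (1-r)/3 < Re s < 1
(`exists_omegaRemainder`).

Over all i the Beta values add up to B(2s-1, 1-s). So the doubled lower half is 2B(2s-1, 1-s) =
2^(2s-1) Γ(s-1/2) Γ(1-s)/√π, by the duplication formula, minus a tail that is holomorphic on the
same strip. Poles thus come only from ζ(3s-1), at 2/3, and from Γ(s-1/2), at 1/2 - k. The strips for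
different r are glued by the identity theorem. The residues are nonzero because ζ((1-6k)/2) ≠ 0: by
the functional equation for k ≥ 1, by an elementary estimate for k = 0.

Every ingredient grows polynomially. The remainder series are bounded up to polynomial factors, the
Gamma product is a bounded Beta integral divided by linear factors, and ζ is controlled by a
recurrence through its values further to the right. -/

open Filter Topology Set MeasureTheory

/-! ### Polynomial growth and its closure properties -/

/-- `f` grows at most polynomially in the imaginary part on the set `S`. -/
def PolyGrowth (f : ℂ → ℂ) (S : Set ℂ) : Prop :=
  ∃ C : ℝ, ∃ M : ℕ, 0 ≤ C ∧ ∀ s ∈ S, 1 ≤ |s.im| → ‖f s‖ ≤ C * |s.im| ^ M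

namespace PolyGrowth

variable {f g : ℂ → ℂ} {S T : Set ℂ}

theorem mono (hf : PolyGrowth f S) (h : T ⊆ S) : PolyGrowth f T := by
  obtain ⟨C, M, hC, H⟩ := hf
  exact ⟨C, M, hC, fun s hs => H s (h hs)⟩

theorem of_le (hg : PolyGrowth g S) (h : ∀ s ∈ S, 1 ≤ |s.im| → ‖f s‖ ≤ ‖g s‖) :
    PolyGrowth f S := by
  obtain ⟨C, M, hC, H⟩ := hg
  exact ⟨C, M, hC, fun s hs ht => (h s hs ht).trans (H s hs ht)⟩

theorem congr (hg : PolyGrowth g S) (h : ∀ s ∈ S, 1 ≤ |s.im| → f s = g s) : PolyGrowth f S :=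
  hg.of_le fun s hs ht => by rw [h s hs ht]

theorem of_bounded {C : ℝ} (h : ∀ s ∈ S, 1 ≤ |s.im| → ‖f s‖ ≤ C) : PolyGrowth f S :=
  ⟨|C|, 0, abs_nonneg C, fun s hs ht => by simpa using (h s hs ht).trans (le_abs_self C)⟩

theorem const (c : ℂ) : PolyGrowth (fun _ => c) S :=
  of_bounded (C := ‖c‖) fun _ _ _ => le_rfl

theorem add (hf : PolyGrowth f S) (hg : PolyGrowth g S) :
    PolyGrowth (fun s => f s + g s) S := by
  obtain ⟨C, M, hC, H⟩ := hf
  obtain ⟨C', M', hC', H'⟩ := hg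
  refine ⟨C + C', max M M', by positivity, fun s hs ht => (norm_add_le _ _).trans ?_⟩
  have h1 : |s.im| ^ M ≤ |s.im| ^ max M M' := pow_le_pow_right₀ ht (le_max_left _ _)
  have h2 : |s.im| ^ M' ≤ |s.im| ^ max M M' := pow_le_pow_right₀ ht (le_max_right _ _)
  rw [add_mul]
  gcongr
  · exact (H s hs ht).trans (by gcongr)
  · exact (H' s hs ht).trans (by gcongr)

theorem mul (hf : PolyGrowth f S) (hg : PolyGrowth g S) :
    PolyGrowth (fun s => f s * g s) S := by
  obtain ⟨C, M, hC, H⟩ := hf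
  obtain ⟨C', M', hC', H'⟩ := hg
  refine ⟨C * C', M + M', by positivity, fun s hs ht => ?_⟩
  calc ‖f s * g s‖ = ‖f s‖ * ‖g s‖ := norm_mul _ _
    _ ≤ (C * |s.im| ^ M) * (C' * |s.im| ^ M') :=
        mul_le_mul (H s hs ht) (H' s hs ht) (norm_nonneg _) (by positivity)
    _ = _ := by ring

theorem neg (hf : PolyGrowth f S) : PolyGrowth (fun s => -f s) S :=
  hf.of_le fun s _ _ => by simp

theorem sub (hf : PolyGrowth f S) (hg : PolyGrowth g S) :
    PolyGrowth (fun s => f s - g s) S := by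
  simpa only [sub_eq_add_neg] using hf.add hg.neg

theorem sum {ι : Type*} (I : Finset ι) {F : ι → ℂ → ℂ} (h : ∀ i ∈ I, PolyGrowth (F i) S) :
    PolyGrowth (fun s => ∑ i ∈ I, F i s) S := by
  classical
  induction I using Finset.induction_on with
  | empty => simpa using const 0
  | insert i I hi ih =>
    simp only [Finset.sum_insert hi]
    exact (h i (by simp)).add (ih fun j hj => h j (by simp [hj]))

theorem prod {ι : Type*} (I : Finset ι) {F : ι → ℂ → ℂ} (h : ∀ i ∈ I, PolyGrowth (F i) S) :
    PolyGrowth (fun s => ∏ i ∈ I, F i s) S := by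
  classical
  induction I using Finset.induction_on with
  | empty => simpa using const 1
  | insert i I hi ih =>
    simp only [Finset.prod_insert hi]
    exact (h i (by simp)).mul (ih fun j hj => h j (by simp [hj]))

theorem id_strip (a b : ℝ) : PolyGrowth (fun s => s) (Complex.re ⁻¹' Icc a b) := by
  refine ⟨|a| + |b| + 1, 1, by positivity, fun s hs ht => ?_⟩
  have h1 : |s.re| ≤ |a| + |b| := by
    rw [abs_le]
    have := hs.1
    have := hs.2
    constructor <;> linarith [neg_abs_le a, le_abs_self b, abs_nonneg a, abs_nonneg b]
  have := Complex.norm_le_abs_re_add_abs_im s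
  nlinarith [abs_nonneg a, abs_nonneg b]

/-- A real shift keeps the imaginary part and the factor m ≥ 1 does not shrink it, so the
restriction |Im| ≥ 1 is preserved. -/
theorem comp_affine {m : ℕ} (hm : m ≠ 0) (c : ℝ)
    (hf : PolyGrowth f T) (h : ∀ s ∈ S, (m : ℂ) * s + c ∈ T) :
    PolyGrowth (fun s => f (m * s + c)) S := by
  obtain ⟨C, M, hC, H⟩ := hf
  have hm1 : (1 : ℝ) ≤ m := by exact_mod_cast Nat.one_le_iff_ne_zero.mpr hm
  refine ⟨C * (m : ℝ) ^ M, M, by positivity, fun s hs ht => ?_⟩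
  have him : |((m : ℂ) * s + c).im| = m * |s.im| := by
    simp [abs_mul]
  have := H _ (h s hs) (by rw [him]; nlinarith)
  rwa [him, mul_pow, ← mul_assoc] at this

theorem inv_of_im (h : ∀ s ∈ S, |s.im| ≤ ‖f s‖) : PolyGrowth (fun s => (f s)⁻¹) S :=
  of_bounded (C := 1) fun s hs ht => by
    rw [norm_inv]
    exact inv_le_one_of_one_le₀ (ht.trans (h s hs))

end PolyGrowth

/-- Weierstrass: a series of holomorphic functions with local summable bounds is holomorphic. -/
theorem differentiableOn_tsum_of_local_bound {ι : Type*} {F : ι → ℂ → ℂ} {U : Set ℂ}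
    (hF : ∀ i, DifferentiableOn ℂ (F i) U)
    (h : ∀ s ∈ U, ∃ V, IsOpen V ∧ V ⊆ U ∧ s ∈ V ∧
      ∃ u : ι → ℝ, Summable u ∧ ∀ i, ∀ w ∈ V, ‖F i w‖ ≤ u i) :
    DifferentiableOn ℂ (fun s => ∑' i, F i s) U := by
  intro s hs
  obtain ⟨V, hV, hVU, hsV, u, hu, hb⟩ := h s hs
  have := Complex.differentiableOn_tsum_of_summable_norm hu (fun i => (hF i).mono hVU) hV hb
  exact (this.differentiableAt (hV.mem_nhds hsV)).differentiableWithinAt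

/-! ### Binomial expansion of (x + h)^(-u) with remainder -/

/-- The coefficients of the binomial series of `(1 + h) ^ (-u)`. -/
noncomputable def negBinom (m : ℕ) (u : ℂ) : ℂ :=
  (-1) ^ m / (m.factorial : ℂ) * ∏ i ∈ Finset.range m, (u + i)

theorem negBinom_zero (u : ℂ) : negBinom 0 u = 1 := by simp [negBinom]

theorem negBinom_succ_mul (m : ℕ) (u : ℂ) :
    (m + 1 : ℂ) * negBinom (m + 1) u = -u * negBinom m (u + 1) := by
  have h1 : ((m : ℂ) + 1) ≠ 0 := by exact_mod_cast Nat.succ_ne_zero m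
  have h2 : (m.factorial : ℂ) ≠ 0 := by exact_mod_cast m.factorial_ne_zero
  rw [negBinom, negBinom, Finset.prod_range_succ', Nat.factorial_succ]
  have : ∏ k ∈ Finset.range m, (u + ((k + 1 : ℕ) : ℂ)) = ∏ k ∈ Finset.range m, (u + 1 + k) :=
    Finset.prod_congr rfl fun k _ => by push_cast; ring
  rw [this]
  push_cast
  field_simp
  ring

theorem differentiable_negBinom (m : ℕ) : Differentiable ℂ (negBinom m) := by
  unfold negBinom
  fun_prop

/-- The remainder of order `M` of the binomial expansion of `(x + h) ^ (-u)` in powers of `h`. -/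
noncomputable def binomRem (M : ℕ) (u : ℂ) (x h : ℝ) : ℂ :=
  ((x + h : ℝ) : ℂ) ^ (-u) - ∑ m ∈ Finset.range M, negBinom m u * (x : ℂ) ^ (-u - m) * (h : ℂ) ^ m

theorem binomRem_at_zero (M : ℕ) (u : ℂ) (x : ℝ) : binomRem (M + 1) u x 0 = 0 := by
  simp [binomRem, Finset.sum_range_succ', negBinom_zero]

/-- The term m = 0 does not depend on h and drops out; the others match through `negBinom_succ_mul`.
This recursion in the order drives the estimate of the remainder. -/
theorem hasDerivAt_binomRem (M : ℕ) (u : ℂ) {x h : ℝ} (hx : 0 < x) (hh : 0 ≤ h) :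
    HasDerivAt (binomRem (M + 1) u x) (-u * binomRem M (u + 1) x h) h := by
  have h1 : HasDerivAt (fun h : ℝ => ((x + h : ℝ) : ℂ) ^ (-u))
      (-u * ((x + h : ℝ) : ℂ) ^ (-u - 1)) h := by
    have hd : HasDerivAt (fun z : ℂ => ((x : ℂ) + z) ^ (-u))
        (-u * ((x : ℂ) + (h : ℂ)) ^ (-u - 1) * 1) (h : ℂ) := by
      refine ((hasDerivAt_id _).const_add (x : ℂ)).cpow_const (c := -u) ?_
      left
      simp
      linarith
    have := hd.comp_ofReal
    simpa using this
  have h2 : HasDerivAt (fun h : ℝ => ∑ m ∈ Finset.range (M + 1),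
      negBinom m u * (x : ℂ) ^ (-u - m) * (h : ℂ) ^ m)
      (∑ m ∈ Finset.range (M + 1),
        negBinom m u * (x : ℂ) ^ (-u - m) * (m * (h : ℂ) ^ (m - 1))) h := by
    refine HasDerivAt.fun_sum fun m _ => HasDerivAt.const_mul _ ?_
    simpa using (hasDerivAt_pow m (h : ℂ)).comp_ofReal
  refine (h1.sub h2).congr_deriv ?_
  symm
  rw [binomRem, mul_sub, Finset.sum_range_succ', Finset.mul_sum]
  congr 1
  · congr 2
    ring
  · simp only [Nat.cast_zero, zero_mul, mul_zero, add_zero]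
    refine Finset.sum_congr rfl fun m _ => ?_
    have := negBinom_succ_mul m u
    have e : -(u + 1) - (m : ℂ) = -u - ((m + 1 : ℕ) : ℂ) := by push_cast; ring
    rw [e, Nat.add_sub_cancel]
    push_cast at this ⊢
    linear_combination (-1) * ((x : ℂ) ^ (-u - ((m : ℂ) + 1)) * (h : ℂ) ^ m) * this

/-- Induction on M with u free: the remainder vanishes at h = 0 and its derivative is a remainder of
lower order at u + 1, so the mean value inequality on [0, 1] carries the bound over and collects the
factors u + i. The power of 2 comes from x ≤ x + h ≤ 2x in the base case. -/
theorem norm_binomRem_le (M : ℕ) : ∀ (u : ℂ) {x h : ℝ}, 1 ≤ x → h ∈ Icc (0 : ℝ) 1 →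
    ‖binomRem M u x h‖ ≤
      ‖∏ i ∈ Finset.range M, (u + i)‖ * (2 ^ |u.re + M| * x ^ (-u.re - M)) := by
  induction M with
  | zero =>
    intro u x h hx hh
    have hx0 : 0 < x := by linarith
    have hxh : 0 < x + h := by linarith [hh.1]
    simp only [binomRem, Finset.range_zero, Finset.sum_empty, sub_zero, Finset.prod_empty,
      norm_one, one_mul, Nat.cast_zero, add_zero]
    rw [Complex.norm_cpow_eq_rpow_re_of_pos hxh, Complex.neg_re]
    rcases le_total 0 u.re with h0 | h0
    · calc (x + h) ^ (-u.re) ≤ x ^ (-u.re) :=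
            Real.rpow_le_rpow_of_nonpos hx0 (by linarith [hh.1]) (by linarith)
        _ ≤ 2 ^ |u.re| * x ^ (-u.re) :=
            le_mul_of_one_le_left (by positivity)
              (Real.one_le_rpow (by norm_num) (abs_nonneg _))
    · rw [abs_of_nonpos h0, ← Real.mul_rpow (by norm_num) hx0.le]
      exact Real.rpow_le_rpow hxh.le (by linarith [hh.2]) (by linarith)
  | succ M ih =>
    intro u x h hx hh
    have hx0 : 0 < x := by linarith
    set K := ‖∏ i ∈ Finset.range (M + 1), (u + i)‖ *
      (2 ^ |u.re + (M + 1 : ℕ)| * x ^ (-u.re - (M + 1 : ℕ))) with hK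
    have hb : ∀ y ∈ Icc (0 : ℝ) 1, ‖-u * binomRem M (u + 1) x y‖ ≤ K := by
      intro y hy
      have := ih (u + 1) hx hy
      rw [norm_mul, norm_neg, hK, Finset.prod_range_succ', norm_mul]
      have e : ∏ k ∈ Finset.range M, (u + ((k + 1 : ℕ) : ℂ)) =
          ∏ k ∈ Finset.range M, (u + 1 + k) :=
        Finset.prod_congr rfl fun k _ => by push_cast; ring
      have e1 : u.re + ((M + 1 : ℕ) : ℝ) = (u + 1).re + M := by simp; ring
      have e2 : -u.re - ((M + 1 : ℕ) : ℝ) = -(u + 1).re - M := by simp; ring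
      rw [e, e1, e2]
      simp only [Nat.cast_zero, add_zero]
      rw [mul_comm _ ‖u‖, mul_assoc]
      exact mul_le_mul_of_nonneg_left this (norm_nonneg _)
    have := (convex_Icc (0 : ℝ) 1).norm_image_sub_le_of_norm_hasDerivWithin_le
      (f := binomRem (M + 1) u x) (x := 0) (y := h) (C := K)
      (fun y hy => (hasDerivAt_binomRem M u hx0 hy.1).hasDerivWithinAt) hb
      (left_mem_Icc.2 zero_le_one) hh
    rw [binomRem_at_zero, sub_zero, sub_zero] at this
    refine this.trans (mul_le_of_le_one_right (by positivity) ?_)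
    rw [Real.norm_eq_abs, abs_of_nonneg hh.1]
    exact hh.2

theorem differentiable_binomRem (M : ℕ) {x h : ℝ} (hx : 0 < x) (hh : 0 ≤ h) :
    Differentiable ℂ fun u => binomRem M u x h := by
  have hx' : (x : ℂ) ≠ 0 := by exact_mod_cast hx.ne'
  have hxh' : ((x + h : ℝ) : ℂ) ≠ 0 := by exact_mod_cast (by positivity : x + h ≠ 0)
  unfold binomRem
  refine Differentiable.sub ?_ (Differentiable.fun_sum fun m _ => ?_)
  · exact (differentiable_id.neg).const_cpow (Or.inl hxh')
  · refine ((differentiable_negBinom m).mul ?_).mul_const _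
    exact (differentiable_id.neg.sub_const _).const_cpow (Or.inl hx')

/-- The quotient of `negBinom m u` by `u + m - 1`, for `m ≥ 1`. -/
noncomputable def negBinomDiv (m : ℕ) (u : ℂ) : ℂ :=
  (-1) ^ m / (m.factorial : ℂ) * ∏ i ∈ Finset.range (m - 1), (u + i)

/-- The split factor u + m is what turns ζ(u + m + 1) into the entire function (u + m) ζ(u + m + 1),
that is `riemannZeta₁`. -/
theorem negBinomDiv_mul (m : ℕ) (u : ℂ) :
    negBinomDiv (m + 1) u * (u + m) = negBinom (m + 1) u := by
  rw [negBinomDiv, negBinom, Nat.add_sub_cancel, Finset.prod_range_succ, mul_assoc]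

theorem differentiable_negBinomDiv (m : ℕ) : Differentiable ℂ (negBinomDiv m) := by
  unfold negBinomDiv
  fun_prop

/-- Bound for the sum of binomial remainders over the positive integers. -/
theorem exists_norm_binomRem_le {M : ℕ} {a b : ℝ} (h : 1 < a + M) :
    ∃ v : ℕ → ℝ, Summable v ∧ (∀ n, 0 ≤ v n) ∧ ∀ u : ℂ, u.re ∈ Icc a b → ∀ n : ℕ,
      ‖binomRem M u (n + 1) 1‖ ≤ ‖∏ i ∈ Finset.range M, (u + i)‖ * v n := by
  refine ⟨fun n => 2 ^ |b + M| * ((n : ℝ) + 1) ^ (-a - M), ?_, fun n => by positivity, ?_⟩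
  · refine Summable.mul_left _ ?_
    have := (summable_nat_add_iff 1).2 (Real.summable_nat_rpow.2 (by linarith : -a - M < -1))
    simpa using this
  · intro u hu n
    refine (norm_binomRem_le M u (by simp) ⟨zero_le_one, le_rfl⟩).trans ?_
    refine mul_le_mul_of_nonneg_left (mul_le_mul ?_ ?_ (by positivity) (by positivity))
      (norm_nonneg _)
    · refine Real.rpow_le_rpow_of_exponent_le (by norm_num) ?_
      rw [abs_of_nonneg (by linarith [hu.1]), abs_of_nonneg (by linarith [hu.1, hu.2])]
      linarith [hu.2]
    · exact Real.rpow_le_rpow_of_exponent_le (by simp) (by linarith [hu.1])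

theorem summable_binomRem {M : ℕ} {u : ℂ} (h : 1 < u.re + M) :
    Summable fun n : ℕ => binomRem M u (n + 1) 1 := by
  obtain ⟨v, hv, -, hb⟩ := exists_norm_binomRem_le (b := u.re) h
  exact Summable.of_norm_bounded (hv.mul_left _) (hb u ⟨le_rfl, le_rfl⟩)

theorem isOpen_re_preimage_Ioo (a b : ℝ) : IsOpen (Complex.re ⁻¹' Ioo a b) :=
  isOpen_Ioo.preimage Complex.continuous_re

theorem differentiableOn_tsum_binomRem (M : ℕ) :
    DifferentiableOn ℂ (fun u => ∑' n : ℕ, binomRem M u (n + 1) 1) {u | 1 - M < u.re} := by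
  refine differentiableOn_tsum_of_local_bound
    (fun n => (differentiable_binomRem M (by positivity) zero_le_one).differentiableOn) ?_
  intro s hs
  obtain ⟨a, ha, has⟩ := exists_between (show 1 - (M : ℝ) < s.re from hs)
  obtain ⟨v, hv, hv0, hb⟩ := exists_norm_binomRem_le (M := M) (a := a) (b := s.re + 1)
    (by linarith)
  have hc : Continuous fun u : ℂ => ‖∏ i ∈ Finset.range M, (u + i)‖ := by fun_prop
  -- The polynomial prefactor is unbounded on a strip, so the neighbourhood is also cut down to
  -- where it stays below B.
  set B := ‖∏ i ∈ Finset.range M, (s + i)‖ + 1 with hB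
  refine ⟨Complex.re ⁻¹' Ioo a (s.re + 1) ∩ {u | ‖∏ i ∈ Finset.range M, (u + i)‖ < B},
    (isOpen_re_preimage_Ioo _ _).inter (isOpen_lt hc continuous_const), ?_, ⟨⟨has, by simp⟩, ?_⟩,
    fun n => B * v n, hv.mul_left _, ?_⟩
  · intro u hu
    exact ha.trans hu.1.1
  · simp [hB]
  · intro n w hw
    exact (hb w ⟨hw.1.1.le, hw.1.2.le⟩ n).trans (mul_le_mul_of_nonneg_right hw.2.le (hv0 n))

/-! ### A recurrence for ζ, its polynomial growth, and ζ(1/2) ≠ 0 -/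

theorem hasSum_nat_add_one_cpow {s : ℂ} (hs : 1 < s.re) :
    HasSum (fun n : ℕ => (((n : ℝ) + 1 : ℝ) : ℂ) ^ (-s)) (riemannZeta s) := by
  rw [zeta_eq_tsum_one_div_nat_add_one_cpow hs]
  have h := (Complex.summable_one_div_nat_cpow (p := s)).2 hs
  have h' := (summable_nat_add_iff 1).2 h
  have e : (fun n : ℕ => (((n : ℝ) + 1 : ℝ) : ℂ) ^ (-s)) = fun n : ℕ => 1 / ((n : ℂ) + 1) ^ s := by
    funext n
    push_cast
    rw [Complex.cpow_neg, one_div]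
  rw [e]
  exact (h'.congr fun n => by push_cast; rfl).hasSum

theorem riemannZeta₁_eq {s : ℂ} (hs : s ≠ 1) : riemannZeta₁ s = (s - 1) * riemannZeta s := by
  rw [riemannZeta_eq_inv_sub_mul hs, mul_inv_cancel_left₀ (sub_ne_zero.2 hs)]

/-- Sum the binomial expansion of ((n+1) + 1)^(-u) over n ≥ 0. The left side gives ζ(u) - 1 and the
term m = 0 gives ζ(u), so ζ(u) cancels and only values further to the right remain. -/
theorem riemannZeta₁_recurrence_of_one_lt {u : ℂ} (M : ℕ) (hu : 1 < u.re) :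
    1 + ∑ m ∈ Finset.range M, negBinomDiv (m + 1) u * riemannZeta₁ (u + (m + 1)) +
      ∑' n : ℕ, binomRem (M + 1) u (n + 1) 1 = 0 := by
  have hz : ∀ m : ℕ, 1 < (u + m).re := fun m => by
    simp
    have : (0 : ℝ) ≤ m := by positivity
    linarith
  have h1 : HasSum (fun n : ℕ => (((n : ℝ) + 1 + 1 : ℝ) : ℂ) ^ (-u)) (riemannZeta u - 1) := by
    have := (hasSum_nat_add_iff' 1).2 (hasSum_nat_add_one_cpow hu)
    simpa using this
  have h2 : HasSum (fun n : ℕ => ∑ m ∈ Finset.range (M + 1),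
      negBinom m u * (((n : ℝ) + 1 : ℝ) : ℂ) ^ (-u - m) * ((1 : ℝ) : ℂ) ^ m)
      (∑ m ∈ Finset.range (M + 1), negBinom m u * riemannZeta (u + m)) := by
    refine hasSum_sum fun m _ => ?_
    have := (hasSum_nat_add_one_cpow (hz m)).mul_left (negBinom m u)
    refine this.congr_fun fun n => ?_
    rw [Complex.ofReal_one, one_pow, mul_one, neg_add']
  have h3 := (h1.sub h2).tsum_eq
  have h4 : ∑' n : ℕ, binomRem (M + 1) u (n + 1) 1 =
      riemannZeta u - 1 - ∑ m ∈ Finset.range (M + 1), negBinom m u * riemannZeta (u + m) := by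
    rw [← h3]
    rfl
  rw [h4, Finset.sum_range_succ']
  have h5 : ∀ m : ℕ, negBinomDiv (m + 1) u * riemannZeta₁ (u + (m + 1)) =
      negBinom (m + 1) u * riemannZeta (u + ((m + 1 : ℕ) : ℂ)) := fun m => by
    have hne : u + ((m : ℂ) + 1) ≠ 1 := by
      intro h
      have := hz (m + 1)
      push_cast at this
      rw [h] at this
      simp at this
    rw [riemannZeta₁_eq hne, ← negBinomDiv_mul]
    push_cast
    ring
  simp only [h5, negBinom_zero, Nat.cast_zero, add_zero, one_mul]
  ring

/-- Since `riemannZeta₁` is entire and the remainder series is holomorphic on Re u > -M, the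
identity theorem extends the relation from Re u > 1. -/
theorem riemannZeta₁_recurrence {u : ℂ} (M : ℕ) (hu : -M < u.re) :
    1 + ∑ m ∈ Finset.range M, negBinomDiv (m + 1) u * riemannZeta₁ (u + (m + 1)) +
      ∑' n : ℕ, binomRem (M + 1) u (n + 1) 1 = 0 := by
  have hopen : ∀ c : ℝ, IsOpen {u : ℂ | c < u.re} := fun c =>
    isOpen_lt continuous_const Complex.continuous_re
  have hd : DifferentiableOn ℂ (fun u =>
      1 + ∑ m ∈ Finset.range M, negBinomDiv (m + 1) u * riemannZeta₁ (u + (m + 1)) +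
      ∑' n : ℕ, binomRem (M + 1) u (n + 1) 1) {u | -M < u.re} := by
    refine DifferentiableOn.add (Differentiable.differentiableOn ?_) ?_
    · have := fun m => differentiable_negBinomDiv m
      fun_prop
    · refine (differentiableOn_tsum_binomRem (M + 1)).mono fun w hw => ?_
      simp only [mem_ofPred_eq] at hw ⊢
      push_cast
      linarith
  have hpre : IsPreconnected {u : ℂ | -(M : ℝ) < u.re} :=
    (convex_halfSpace_re_gt (-(M : ℝ))).isPreconnected
  have h2 : (2 : ℂ) ∈ {u : ℂ | -(M : ℝ) < u.re} := by
    simp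
    have : (0 : ℝ) ≤ M := by positivity
    linarith
  have := (hd.analyticOnNhd (hopen _)).eqOn_zero_of_preconnected_of_eventuallyEq_zero hpre h2 ?_
  · exact this hu
  · filter_upwards [(hopen 1).mem_nhds (show (2 : ℂ) ∈ {u : ℂ | (1 : ℝ) < u.re} by simp)] with w hw
    exact riemannZeta₁_recurrence_of_one_lt M hw

/-- The recurrence at u = s - 1 expresses `riemannZeta₁ s` by its values at s + 1, s + 2, … with
polynomial coefficients and a remainder of polynomial size. The bound therefore moves left by one
unit per step, starting from Re s ≥ 2, where ζ is bounded. -/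
theorem polyGrowth_riemannZeta₁_aux (n : ℕ) : ∀ a b : ℝ, 2 - n ≤ a →
    PolyGrowth riemannZeta₁ (Complex.re ⁻¹' Icc a b) := by
  induction n with
  | zero =>
    intro a b ha
    have h : PolyGrowth (fun s => (s - 1) * riemannZeta s) (Complex.re ⁻¹' Icc a b) := by
      refine ((PolyGrowth.id_strip a b).sub (.const 1)).mul ?_
      have hs2 := Real.summable_nat_rpow.2 (by norm_num : (-2 : ℝ) < -1)
      have hs2' := (summable_nat_add_iff 1).2 hs2
      refine PolyGrowth.of_bounded (C := ∑' n : ℕ, ((n + 1 : ℕ) : ℝ) ^ (-2 : ℝ)) fun s hs _ => ?_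
      have hs1 : 2 ≤ s.re := by
        have := hs.1
        simp at ha
        linarith
      rw [← (hasSum_nat_add_one_cpow (s := s) (by linarith)).tsum_eq]
      refine tsum_of_norm_bounded hs2'.hasSum fun n => ?_
      rw [Complex.norm_cpow_eq_rpow_re_of_pos (by positivity)]
      push_cast
      refine Real.rpow_le_rpow_of_exponent_le (by simp) ?_
      simp
      linarith
    refine h.congr fun s _ ht => riemannZeta₁_eq ?_
    rintro rfl
    norm_num at ht
  | succ n ih =>
    intro a b ha
    -- Large enough for the remainder of order M + 2 to be summable on the shifted strip, which
    -- starts at a - 1.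
    obtain ⟨M, hM⟩ := exists_nat_gt (2 - a)
    have hstrip : ∀ s ∈ Complex.re ⁻¹' Icc a b, s - 1 ∈ Complex.re ⁻¹' Icc (a - 1) (b - 1) := by
      intro s hs
      simp only [mem_preimage, Complex.sub_re, Complex.one_re]
      exact ⟨by linarith [hs.1], by linarith [hs.2]⟩
    have hid : PolyGrowth (fun s => s - 1) (Complex.re ⁻¹' Icc a b) :=
      (PolyGrowth.id_strip a b).sub (.const 1)
    obtain ⟨v, hv, hv0, hb⟩ := exists_norm_binomRem_le (M := M + 2) (a := a - 1) (b := b - 1)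
      (by push_cast; linarith)
    have hrem : PolyGrowth (fun s => ∑' k : ℕ, binomRem (M + 2) (s - 1) (k + 1) 1)
        (Complex.re ⁻¹' Icc a b) := by
      have hp : PolyGrowth (fun s => (∏ i ∈ Finset.range (M + 2), ((s - 1) + i)) *
          ((∑' k, v k : ℝ) : ℂ)) (Complex.re ⁻¹' Icc a b) :=
        (PolyGrowth.prod _ fun i _ => hid.add (.const _)).mul (.const _)
      refine hp.of_le fun s hs _ => ?_
      rw [norm_mul, Complex.norm_of_nonneg (tsum_nonneg hv0)]
      exact tsum_of_norm_bounded (hv.hasSum.mul_left _) (hb _ (hstrip s hs))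
    have hmain : PolyGrowth (fun s => 1 +
        ∑ m ∈ Finset.range M, negBinomDiv (m + 2) (s - 1) * riemannZeta₁ (s + (m + 1 : ℝ)) +
        ∑' k : ℕ, binomRem (M + 2) (s - 1) (k + 1) 1) (Complex.re ⁻¹' Icc a b) := by
      refine ((PolyGrowth.const 1).add (.sum _ fun m hm => .mul ?_ ?_)).add hrem
      · exact (PolyGrowth.const _).mul (.prod _ fun i _ => hid.add (.const _))
      · have h := (ih (a + 1) (b + M) (by push_cast at ha; linarith)).comp_affine (m := 1)
          (S := Complex.re ⁻¹' Icc a b) one_ne_zero (m + 1 : ℝ) ?_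
        · simpa using h
        · intro s hs
          have hmM : (m : ℝ) + 1 ≤ M := by exact_mod_cast Finset.mem_range.1 hm
          have : (0 : ℝ) ≤ m := by positivity
          simp only [mem_preimage, Nat.cast_one, one_mul, Complex.add_re, Complex.ofReal_re]
          exact ⟨by linarith [hs.1], by linarith [hs.2]⟩
    refine hmain.congr fun s hs _ => ?_
    have h := riemannZeta₁_recurrence (u := s - 1) (M + 1) (by
      have := (hstrip s hs).1
      push_cast
      linarith)
    rw [Finset.sum_range_succ'] at h
    have e0 : negBinomDiv (0 + 1) (s - 1) * riemannZeta₁ (s - 1 + (((0 : ℕ) : ℂ) + 1)) =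
        -riemannZeta₁ s := by
      simp [negBinomDiv]
    have e1 : ∀ m : ℕ, s - 1 + (((m + 1 : ℕ) : ℂ) + 1) = s + ((m + 1 : ℝ) : ℂ) := fun m => by
      push_cast
      ring
    rw [e0] at h
    simp only [e1] at h
    linear_combination -h

theorem polyGrowth_riemannZeta₁ (a b : ℝ) : PolyGrowth riemannZeta₁ (Complex.re ⁻¹' Icc a b) := by
  obtain ⟨n, hn⟩ := exists_nat_gt (2 - a)
  exact polyGrowth_riemannZeta₁_aux n a b (by linarith)

theorem abs_im_le_norm_sub_one (s : ℂ) : |s.im| ≤ ‖s - 1‖ := by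
  simpa using Complex.abs_im_le_norm (s - 1)

theorem polyGrowth_riemannZeta (a b : ℝ) : PolyGrowth riemannZeta (Complex.re ⁻¹' Icc a b) := by
  refine ((PolyGrowth.inv_of_im (f := fun s => s - 1) fun s _ => abs_im_le_norm_sub_one s).mul
    (polyGrowth_riemannZeta₁ a b)).congr fun s _ ht => riemannZeta_eq_inv_sub_mul ?_
  rintro rfl
  norm_num at ht

/-- If ζ(1/2) were 0, the recurrence at u = -1/2 would give Σ r_n = -1 with r_n = √(n+2) - √(n+1) -
1/(2√(n+1)). But √(n+2) - √(n+1) ≥ 1/(2√(n+2)), so the partial sums are bounded below by a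
telescoping sum that is at least -1/2. -/
theorem riemannZeta_one_half_ne_zero : riemannZeta (1 / 2) ≠ 0 := by
  intro h0
  have h := riemannZeta₁_recurrence (u := -(1 / 2)) 1 (by norm_num)
  have e : riemannZeta₁ (-(1 / 2) + (((0 : ℕ) : ℂ) + 1)) = 0 := by
    rw [show (-(1 / 2) + (((0 : ℕ) : ℂ) + 1) : ℂ) = 1 / 2 by norm_num,
      riemannZeta₁_eq (by norm_num), h0, mul_zero]
  rw [Finset.sum_range_one, e, mul_zero, add_zero] at h
  have hsum := summable_binomRem (M := 2) (u := -(1 / 2)) (by norm_num)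
  have hterm : ∀ n : ℕ, binomRem 2 (-(1 / 2)) (n + 1) 1 =
      ((√((n : ℝ) + 2) - √((n : ℝ) + 1) - 1 / (2 * √((n : ℝ) + 1)) : ℝ) : ℂ) := by
    intro n
    have hn : (0 : ℝ) < n + 1 := by positivity
    have e1 : (((n : ℝ) + 1 : ℝ) : ℂ) ^ (1 / 2 : ℂ) = ((√((n : ℝ) + 1) : ℝ) : ℂ) := by
      rw [Real.sqrt_eq_rpow, Complex.ofReal_cpow hn.le]
      norm_num
    have e2 : (((n : ℝ) + 1 + 1 : ℝ) : ℂ) ^ (1 / 2 : ℂ) = ((√((n : ℝ) + 2) : ℝ) : ℂ) := by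
      rw [Real.sqrt_eq_rpow, add_assoc, one_add_one_eq_two, Complex.ofReal_cpow (by positivity)]
      norm_num
    have e3 : (((n : ℝ) + 1 : ℝ) : ℂ) ^ (1 / 2 - 1 : ℂ) = ((1 / √((n : ℝ) + 1) : ℝ) : ℂ) := by
      rw [show (1 / 2 - 1 : ℂ) = -(1 / 2) by norm_num, Complex.cpow_neg, e1]
      push_cast
      rw [one_div]
    simp only [binomRem, Finset.sum_range_succ, Finset.range_zero, Finset.sum_empty, zero_add,
      negBinom, neg_neg, Finset.prod_empty, Nat.cast_zero, sub_zero, Nat.cast_one, e1, e2, e3]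
    simp
    ring
  set r : ℕ → ℝ := fun n => √((n : ℝ) + 2) - √((n : ℝ) + 1) - 1 / (2 * √((n : ℝ) + 1)) with hr
  have hsum' : Summable r := by
    rw [← Complex.summable_ofReal]
    exact hsum.congr hterm
  have hval : ∑' n, r n = -1 := by
    have : ((∑' n, r n : ℝ) : ℂ) = -1 := by
      rw [Complex.ofReal_tsum]
      rw [tsum_congr hterm] at h
      linear_combination h
    exact_mod_cast this
  have hlow : ∀ n : ℕ, 1 / (2 * √((n : ℝ) + 2)) - 1 / (2 * √((n : ℝ) + 1)) ≤ r n := by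
    intro n
    have h1 : 0 < √((n : ℝ) + 1) := Real.sqrt_pos.2 (by positivity)
    have h2 : √((n : ℝ) + 1) ≤ √((n : ℝ) + 2) := Real.sqrt_le_sqrt (by linarith)
    have h2' : 0 < √((n : ℝ) + 2) := h1.trans_le h2
    have h3 : (√((n : ℝ) + 2) - √((n : ℝ) + 1)) * (√((n : ℝ) + 2) + √((n : ℝ) + 1)) = 1 := by
      have a1 := Real.mul_self_sqrt (show (0 : ℝ) ≤ n + 2 by positivity)
      have a2 := Real.mul_self_sqrt (show (0 : ℝ) ≤ n + 1 by positivity)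
      linear_combination a1 - a2
    have h4 : 1 / (2 * √((n : ℝ) + 2)) ≤ √((n : ℝ) + 2) - √((n : ℝ) + 1) := by
      rw [div_le_iff₀ (by positivity)]
      nlinarith
    simp only [hr]
    linarith
  have hpart : ∀ N : ℕ, -(1 / 2 : ℝ) ≤ ∑ n ∈ Finset.range N, r n := by
    intro N
    refine le_trans ?_ (Finset.sum_le_sum fun n _ => hlow n)
    have e := Finset.sum_range_sub (fun n : ℕ => 1 / (2 * √((n : ℝ) + 1))) N
    have e' : ∀ n : ℕ, 1 / (2 * √((n : ℝ) + 2)) - 1 / (2 * √((n : ℝ) + 1)) =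
        1 / (2 * √(((n + 1 : ℕ) : ℝ) + 1)) - 1 / (2 * √((n : ℝ) + 1)) := fun n => by
      push_cast
      rw [add_assoc (n : ℝ), one_add_one_eq_two]
    rw [Finset.sum_congr rfl fun n _ => e' n, e]
    norm_num
  have := ge_of_tendsto' hsum'.hasSum.tendsto_sum_nat hpart
  rw [hval] at this
  norm_num at this

/-! ### Euler–Maclaurin summation on [0, ∞) -/

/-- The periodic Bernoulli function of order `l`, divided by `l!`. -/
noncomputable def perBernoulli (l : ℕ) (x : ℝ) : ℝ :=
  bernoulliFun l (Int.fract x) / l.factorial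

theorem perBernoulli_zero (x : ℝ) : perBernoulli 0 x = 1 := by
  simp [perBernoulli, bernoulliFun_zero]

theorem measurable_perBernoulli (l : ℕ) : Measurable (perBernoulli l) :=
  ((continuous_bernoulliFun l).measurable.comp measurable_fract).div_const _

theorem exists_abs_perBernoulli_le (l : ℕ) : ∃ C, 0 ≤ C ∧ ∀ x, |perBernoulli l x| ≤ C := by
  obtain ⟨C, hC⟩ := isCompact_Icc.exists_bound_of_continuousOn
    ((continuous_bernoulliFun l).continuousOn (s := Icc (0 : ℝ) 1))
  have h : ∀ x, |perBernoulli l x| ≤ C / l.factorial := fun x => by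
    rw [perBernoulli, abs_div, Nat.abs_cast]
    gcongr
    exact hC _ ⟨Int.fract_nonneg x, (Int.fract_lt_one x).le⟩
  exact ⟨C / l.factorial, (abs_nonneg _).trans (h 0), h⟩

theorem perBernoulli_eq_of_mem {l k : ℕ} {x : ℝ} (hx : x ∈ Ico (k : ℝ) (k + 1)) :
    perBernoulli l x = bernoulliFun l (x - k) / l.factorial := by
  have : Int.fract x = x - k := by
    rw [Int.fract_eq_iff]
    exact ⟨by linarith [hx.1], by linarith [hx.2], ⟨k, by simp⟩⟩
  rw [perBernoulli, this]

theorem hasDerivAt_bernoulliFun_div_factorial (l : ℕ) (x : ℝ) :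
    HasDerivAt (fun y => bernoulliFun (l + 1) y / (l + 1).factorial)
      (bernoulliFun l x / l.factorial) x := by
  have h := (hasDerivAt_bernoulliFun (l + 1) x).div_const ((l + 1).factorial : ℝ)
  refine h.congr_deriv ?_
  have : (l.factorial : ℝ) ≠ 0 := by exact_mod_cast l.factorial_ne_zero
  rw [Nat.factorial_succ, Nat.add_sub_cancel]
  push_cast
  field_simp

theorem intervalIntegral_perBernoulli_mul {l k : ℕ} (f : ℝ → ℂ) :
    ∫ x in (k : ℝ)..(k + 1), (perBernoulli l x : ℂ) * f x =
      ∫ x in (k : ℝ)..(k + 1), ((bernoulliFun l (x - k) / l.factorial : ℝ) : ℂ) * f x := by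
  -- The half-open interval closed on the left is needed: at x = k + 1 the fractional part is 0, not
  -- x - k.
  rw [intervalIntegral.integral_of_le (by linarith), intervalIntegral.integral_of_le (by linarith),
    ← integral_Ico_eq_integral_Ioc, ← integral_Ico_eq_integral_Ioc]
  exact setIntegral_congr_fun measurableSet_Ico fun x hx => by
    simp only [perBernoulli_eq_of_mem hx]

section EulerMaclaurin

variable {f f' : ℝ → ℂ}

theorem MeasureTheory.IntegrableOn.perBernoulli_mul {S : Set ℝ} (l : ℕ) (hf : IntegrableOn f S) :
    IntegrableOn (fun x => (perBernoulli l x : ℂ) * f x) S := by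
  obtain ⟨C, -, hC⟩ := exists_abs_perBernoulli_le l
  refine Integrable.bdd_mul hf
    (Complex.measurable_ofReal.comp (measurable_perBernoulli l)).aestronglyMeasurable
    (c := C) (Eventually.of_forall fun x => ?_)
  simpa using hC x

theorem intervalIntegral_perBernoulli_mul_unit (l k : ℕ) (hf : ContinuousOn f (Ici 0))
    (hd : ∀ x ∈ Ioi (0 : ℝ), HasDerivAt f (f' x) x) (hf' : IntegrableOn f' (Ioi 0)) :
    ∫ x in (k : ℝ)..(k + 1), (perBernoulli l x : ℂ) * f x =
      ((bernoulliFun (l + 1) 1 / (l + 1).factorial : ℝ) : ℂ) * f (k + 1) -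
      ((bernoulliFun (l + 1) 0 / (l + 1).factorial : ℝ) : ℂ) * f k -
      ∫ x in (k : ℝ)..(k + 1), (perBernoulli (l + 1) x : ℂ) * f' x := by
  have hk : (0 : ℝ) ≤ k := by positivity
  have hk1 : (k : ℝ) ≤ k + 1 := by linarith
  rw [intervalIntegral_perBernoulli_mul, intervalIntegral_perBernoulli_mul]
  have hv : ∀ x : ℝ, HasDerivAt
      (fun y : ℝ => ((bernoulliFun (l + 1) (y - k) / (l + 1).factorial : ℝ) : ℂ))
      ((bernoulliFun l (x - k) / l.factorial : ℝ) : ℂ) x := fun x =>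
    HasDerivAt.ofReal_comp ((hasDerivAt_bernoulliFun_div_factorial l (x - k)).comp_sub_const x k)
  have h := intervalIntegral.integral_mul_deriv_eq_deriv_mul_of_hasDerivAt
    (a := (k : ℝ)) (b := k + 1) (u := f) (u' := f')
    (hf.mono fun x hx => by
      rw [uIcc_of_le hk1] at hx
      exact hk.trans hx.1)
    (fun x _ => (hv x).continuousAt.continuousWithinAt)
    (fun x hx => hd x (by
      rw [min_eq_left hk1] at hx
      exact hk.trans_lt hx.1))
    (fun x _ => hv x)
    ((intervalIntegrable_iff_integrableOn_Ioc_of_le hk1).2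
      (hf'.mono_set fun x hx => hk.trans_lt hx.1))
    (Continuous.intervalIntegrable (by
      have := continuous_bernoulliFun l
      fun_prop) _ _)
  simp only [mul_comm (f _), mul_comm (f' _)] at h
  rw [h]
  simp

theorem intervalIntegral_perBernoulli_mul_nat (l n : ℕ) (hf : ContinuousOn f (Ici 0))
    (hd : ∀ x ∈ Ioi (0 : ℝ), HasDerivAt f (f' x) x) (hf' : IntegrableOn f' (Ioi 0)) :
    ∫ x in (0 : ℝ)..n, (perBernoulli l x : ℂ) * f x =
      ∑ k ∈ Finset.range n,
        (((bernoulliFun (l + 1) 1 / (l + 1).factorial : ℝ) : ℂ) * f (k + 1) -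
        ((bernoulliFun (l + 1) 0 / (l + 1).factorial : ℝ) : ℂ) * f k) -
      ∫ x in (0 : ℝ)..n, (perBernoulli (l + 1) x : ℂ) * f' x := by
  have hfi : ∀ k : ℕ, IntervalIntegrable (fun x => (perBernoulli l x : ℂ) * f x) volume k
      ((k + 1 : ℕ) : ℝ) := fun k => by
    have hle : (k : ℝ) ≤ ((k + 1 : ℕ) : ℝ) := by simp
    rw [intervalIntegrable_iff_integrableOn_Icc_of_le hle]
    refine IntegrableOn.perBernoulli_mul l (ContinuousOn.integrableOn_Icc (hf.mono fun x hx => ?_))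
    exact (show (0 : ℝ) ≤ k by positivity).trans hx.1
  have hfi' : ∀ k : ℕ, IntervalIntegrable (fun x => (perBernoulli (l + 1) x : ℂ) * f' x) volume k
      ((k + 1 : ℕ) : ℝ) := fun k => by
    have hle : (k : ℝ) ≤ ((k + 1 : ℕ) : ℝ) := by simp
    rw [intervalIntegrable_iff_integrableOn_Ioc_of_le hle]
    refine IntegrableOn.perBernoulli_mul _ (hf'.mono_set fun x hx => ?_)
    exact (show (0 : ℝ) ≤ k by positivity).trans_lt hx.1
  have e1 := intervalIntegral.sum_integral_adjacent_intervals (a := fun k : ℕ => (k : ℝ)) (n := n)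
    fun k _ => hfi k
  have e2 := intervalIntegral.sum_integral_adjacent_intervals (a := fun k : ℕ => (k : ℝ)) (n := n)
    fun k _ => hfi' k
  simp only [Nat.cast_zero] at e1 e2
  rw [← e1, ← e2, ← Finset.sum_sub_distrib]
  refine Finset.sum_congr rfl fun k _ => ?_
  have := intervalIntegral_perBernoulli_mul_unit l k hf hd hf'
  push_cast at this ⊢
  exact this

/-- For l ≥ 1 the Bernoulli polynomial of degree l + 1 has equal values at 0 and 1, so the boundary
terms telescope to a multiple of f(n) - f(0), where f(0) = 0 and f(n) → 0. -/
theorem integral_perBernoulli_mul_by_parts {l : ℕ} (hl : l ≠ 0) (hf : ContinuousOn f (Ici 0))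
    (hf0 : f 0 = 0) (hd : ∀ x ∈ Ioi (0 : ℝ), HasDerivAt f (f' x) x)
    (hfi : IntegrableOn f (Ioi 0)) (hf' : IntegrableOn f' (Ioi 0)) :
    ∫ x in Ioi (0 : ℝ), (perBernoulli l x : ℂ) * f x =
      -∫ x in Ioi (0 : ℝ), (perBernoulli (l + 1) x : ℂ) * f' x := by
  have h1 := intervalIntegral_tendsto_integral_Ioi (0 : ℝ) (hfi.perBernoulli_mul l)
    tendsto_natCast_atTop_atTop
  have h2 := intervalIntegral_tendsto_integral_Ioi (0 : ℝ) (hf'.perBernoulli_mul (l + 1))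
    tendsto_natCast_atTop_atTop
  have h3 : Tendsto (fun n : ℕ => f n) atTop (𝓝 0) :=
    (tendsto_zero_of_hasDerivAt_of_integrableOn_Ioi hd hf' hfi).comp tendsto_natCast_atTop_atTop
  have h4 := (h3.const_mul ((bernoulliFun (l + 1) 0 / (l + 1).factorial : ℝ) : ℂ)).sub h2
  refine tendsto_nhds_unique h1 ((h4.congr fun n => ?_).trans (by simp))
  rw [intervalIntegral_perBernoulli_mul_nat l n hf hd hf',
    bernoulliFun_endpoints_eq_of_ne_one (by omega)]
  simp only [← mul_sub]
  rw [← Finset.mul_sum]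
  have := Finset.sum_range_sub (fun k : ℕ => f k) n
  push_cast at this
  rw [this, hf0, sub_zero]

/-- First order Euler–Maclaurin summation on `[0, ∞)`. -/
theorem tendsto_sum_eq_integral_add (hf : ContinuousOn f (Ici 0))
    (hf0 : f 0 = 0) (hd : ∀ x ∈ Ioi (0 : ℝ), HasDerivAt f (f' x) x)
    (hfi : IntegrableOn f (Ioi 0)) (hf' : IntegrableOn f' (Ioi 0)) :
    Tendsto (fun n : ℕ => ∑ k ∈ Finset.range n, f (k + 1)) atTop
      (𝓝 ((∫ x in Ioi (0 : ℝ), f x) +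
        ∫ x in Ioi (0 : ℝ), (perBernoulli 1 x : ℂ) * f' x)) := by
  have h1 := intervalIntegral_tendsto_integral_Ioi (0 : ℝ) hfi tendsto_natCast_atTop_atTop
  have h2 := intervalIntegral_tendsto_integral_Ioi (0 : ℝ) (hf'.perBernoulli_mul 1)
    tendsto_natCast_atTop_atTop
  have h3 : Tendsto (fun n : ℕ => f n) atTop (𝓝 0) :=
    (tendsto_zero_of_hasDerivAt_of_integrableOn_Ioi hd hf' hfi).comp tendsto_natCast_atTop_atTop
  -- Since B₁(1) = 1/2 and B₁(0) = -1/2, the parts formula gives the trapezoidal sum, which differs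
  -- from Σ f(k+1) by f(n)/2, a null sequence.
  have h4 := (h1.add h2).add (h3.const_mul (1 / 2))
  rw [mul_zero, add_zero] at h4
  refine h4.congr fun n => ?_
  have h := intervalIntegral_perBernoulli_mul_nat 0 n hf hd hf'
  simp only [perBernoulli_zero, Complex.ofReal_one, one_mul, zero_add, bernoulliFun_one] at h
  rw [h]
  have := Finset.sum_range_sub (fun k : ℕ => f k) n
  push_cast at this
  rw [hf0, sub_zero] at this
  rw [← this, sub_add_cancel, Finset.mul_sum, ← Finset.sum_add_distrib]
  refine Finset.sum_congr rfl fun k _ => ?_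
  push_cast
  norm_num
  ring

end EulerMaclaurin

/-! ### Holomorphic dependence of integrals on a parameter -/

/-- An integral depending holomorphically on a parameter, with local integrable bounds, is
holomorphic. -/
theorem differentiableOn_integral_of_local_bound {α : Type*} [MeasurableSpace α] {μ : Measure α}
    {F : ℂ → α → ℂ} {U : Set ℂ} (hU : IsOpen U)
    (hm : ∀ s ∈ U, AEStronglyMeasurable (F s) μ)
    (hF : ∀ᵐ a ∂μ, DifferentiableOn ℂ (fun s => F s a) U)
    (h : ∀ s ∈ U, ∃ V ∈ 𝓝 s, ∃ v : α → ℝ, Integrable v μ ∧ ∀ᵐ a ∂μ, ∀ w ∈ V, ‖F w a‖ ≤ v a) :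
    DifferentiableOn ℂ (fun s => ∫ a, F s a ∂μ) U := by
  intro s hs
  obtain ⟨V, hV, v, hv, hb⟩ := h s hs
  obtain ⟨r, hr, hball⟩ := Metric.mem_nhds_iff.1 (inter_mem hV (hU.mem_nhds hs))
  have hr2 : 0 < r / 2 := by positivity
  -- As r/2 + r/3 < r, circles of radius r/3 around these points stay where the bound holds;
  -- Cauchy's estimate then dominates the derivative.
  have hmem : ∀ w ∈ Metric.ball s (r / 2), Metric.closedBall w (r / 3) ⊆ Metric.ball s r := by
    intro w hw z hz
    rw [Metric.mem_closedBall] at hz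
    rw [Metric.mem_ball] at hw ⊢
    linarith [dist_triangle z w s]
  have hsub : Metric.ball s (r / 2) ⊆ U := fun w hw =>
    (hball (hmem w hw (Metric.mem_closedBall_self (by positivity)))).2
  have hdiff : ∀ᵐ a ∂μ, ∀ w ∈ Metric.ball s (r / 2),
      HasDerivAt (fun z => F z a) (deriv (fun z => F z a) w) w := by
    filter_upwards [hF] with a ha w hw
    exact (ha.differentiableAt (hU.mem_nhds (hsub hw))).hasDerivAt
  -- The derivative is measurable in `a` as a limit of difference quotients along a real sequence t
  -- n → 0 with s + t n in U.
  have hderiv_meas : AEStronglyMeasurable (fun a => deriv (fun z => F z a) s) μ := by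
    set t : ℕ → ℂ := fun n => ((r / 2 * (1 / ((n : ℝ) + 2)) : ℝ) : ℂ) with ht
    have ht0 : ∀ n, t n ≠ 0 := fun n => by
      simp only [ht, ne_eq, Complex.ofReal_eq_zero]
      exact (by positivity : r / 2 * (1 / ((n : ℝ) + 2)) ≠ 0)
    have htU : ∀ n, s + t n ∈ U := fun n => hsub (by
      rw [Metric.mem_ball, dist_eq_norm, add_sub_cancel_left, ht, Complex.norm_of_nonneg
        (by positivity)]
      refine mul_lt_of_lt_one_right hr2 ?_
      rw [div_lt_one (by positivity)]
      have : (0 : ℝ) ≤ n := by positivity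
      linarith)
    have hlim : Tendsto t atTop (𝓝[≠] 0) := by
      refine tendsto_nhdsWithin_iff.2 ⟨?_, Eventually.of_forall ht0⟩
      have h1 : Tendsto (fun n : ℕ => 1 / ((n : ℝ) + 2)) atTop (𝓝 0) := by
        simp only [one_div]
        exact tendsto_inv_atTop_zero.comp
          (tendsto_atTop_add_const_right _ _ tendsto_natCast_atTop_atTop)
      have h2 := (Complex.continuous_ofReal.tendsto _).comp (h1.const_mul (r / 2))
      rw [mul_zero] at h2
      exact h2
    refine aestronglyMeasurable_of_tendsto_ae atTop
      (f := fun n a => (t n)⁻¹ • (F (s + t n) a - F s a))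
      (fun n => ((hm _ (htU n)).sub (hm s hs)).const_smul ((t n)⁻¹)) ?_
    filter_upwards [hdiff] with a ha
    exact (hasDerivAt_iff_tendsto_slope_zero.1 (ha s (Metric.mem_ball_self hr2))).comp hlim
  have hbound : ∀ᵐ a ∂μ, ∀ w ∈ Metric.ball s (r / 2),
      ‖deriv (fun z => F z a) w‖ ≤ v a / (r / 3) := by
    filter_upwards [hF, hb] with a ha hba w hw
    refine Complex.norm_deriv_le_of_forall_mem_sphere_norm_le (by positivity) ?_ ?_
    · refine DifferentiableOn.diffContOnCl (ha.mono ?_)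
      rw [closure_ball w (by positivity)]
      exact fun z hz => (hball (hmem w hw hz)).2
    · exact fun z hz => hba z (hball (hmem w hw (Metric.sphere_subset_closedBall hz))).1
  have hint : Integrable (F s) μ := by
    refine hv.mono' (hm s hs) ?_
    filter_upwards [hb] with a ha
    exact ha s (mem_of_mem_nhds hV)
  exact (hasDerivAt_integral_of_dominated_loc_of_deriv_le (Metric.ball_mem_nhds s hr2)
    (by filter_upwards [hU.mem_nhds hs] with w hw using hm w hw) hint hderiv_meas hbound
    (hv.div_const _) hdiff).2.differentiableAt.differentiableWithinAt

/-! ### Bounds and continuity for the Beta integral -/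

theorem norm_betaIntegral_le (u v : ℂ) :
    ‖Complex.betaIntegral u v‖ ≤ ‖Complex.betaIntegral u.re v.re‖ := by
  have h : Complex.betaIntegral u.re v.re =
      ((∫ x in (0 : ℝ)..1, x ^ (u.re - 1) * (1 - x) ^ (v.re - 1) : ℝ) : ℂ) := by
    rw [Complex.betaIntegral, ← intervalIntegral.integral_ofReal]
    refine intervalIntegral.integral_congr fun x hx => ?_
    rw [uIcc_of_le zero_le_one] at hx
    push_cast
    rw [Complex.ofReal_cpow hx.1, Complex.ofReal_cpow (sub_nonneg.2 hx.2)]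
    push_cast
    rfl
  rw [h, Complex.norm_real, Complex.betaIntegral]
  refine (intervalIntegral.norm_integral_le_integral_norm zero_le_one).trans
    (le_of_eq_of_le ?_ (le_abs_self _))
  rw [intervalIntegral.integral_of_le zero_le_one, intervalIntegral.integral_of_le zero_le_one,
    ← setIntegral_congr_set Ioo_ae_eq_Ioc, ← setIntegral_congr_set Ioo_ae_eq_Ioc]
  refine setIntegral_congr_fun measurableSet_Ioo fun x hx => ?_
  rw [norm_mul, Complex.norm_cpow_eq_rpow_re_of_pos hx.1, ← Complex.ofReal_one,
    ← Complex.ofReal_sub, Complex.norm_cpow_eq_rpow_re_of_pos (sub_pos.2 hx.2)]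
  simp

theorem differentiableAt_Gamma_of_re_pos {u : ℂ} (hu : 0 < u.re) :
    DifferentiableAt ℂ Complex.Gamma u := by
  refine Complex.differentiableAt_Gamma u fun m h => ?_
  rw [h] at hu
  simp at hu
  linarith [(Nat.cast_nonneg m : (0 : ℝ) ≤ m)]

theorem continuousOn_betaIntegral :
    ContinuousOn (fun z : ℂ × ℂ => Complex.betaIntegral z.1 z.2) {z | 0 < z.1.re ∧ 0 < z.2.re} := by
  have h : ContinuousOn (fun z : ℂ × ℂ => Complex.Gamma z.1 * Complex.Gamma z.2 *
      (Complex.Gamma (z.1 + z.2))⁻¹) {z | 0 < z.1.re ∧ 0 < z.2.re} := by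
    intro z hz
    refine ContinuousAt.continuousWithinAt (ContinuousAt.mul (ContinuousAt.mul ?_ ?_) ?_)
    · exact ContinuousAt.comp (f := Prod.fst)
        (differentiableAt_Gamma_of_re_pos hz.1).continuousAt continuousAt_fst
    · exact ContinuousAt.comp (f := Prod.snd)
        (differentiableAt_Gamma_of_re_pos hz.2).continuousAt continuousAt_snd
    · exact (Complex.differentiable_one_div_Gamma.continuous.comp
        (continuous_fst.add continuous_snd)).continuousAt
  refine h.congr fun z hz => ?_
  simp only
  rw [Complex.betaIntegral_eq_Gamma_mul_div _ _ hz.1 hz.2, div_eq_mul_inv]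

/-- Only the real parts of the arguments matter, and they run over a compact segment in the open
positive quadrant, where B is continuous. -/
theorem exists_norm_betaIntegral_le {a b m c m' c' : ℝ}
    (h : ∀ σ ∈ Icc a b, 0 < m * σ + c ∧ 0 < m' * σ + c') :
    ∃ C, 0 ≤ C ∧ ∀ σ ∈ Icc a b, ∀ u v : ℂ, u.re = m * σ + c → v.re = m' * σ + c' →
      ‖Complex.betaIntegral u v‖ ≤ C := by
  have hc : ContinuousOn (fun σ : ℝ => Complex.betaIntegral ((m * σ + c : ℝ) : ℂ)
      ((m' * σ + c' : ℝ) : ℂ)) (Icc a b) := by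
    refine continuousOn_betaIntegral.comp (f := fun σ : ℝ => ((((m * σ + c : ℝ) : ℂ),
      ((m' * σ + c' : ℝ) : ℂ)) : ℂ × ℂ)) (Continuous.continuousOn (by fun_prop)) fun σ hσ => ?_
    exact ⟨by simpa using (h σ hσ).1, by simpa using (h σ hσ).2⟩
  obtain ⟨C, hC⟩ := isCompact_Icc.exists_bound_of_continuousOn hc
  refine ⟨|C|, abs_nonneg _, fun σ hσ u v hu hv => (norm_betaIntegral_le u v).trans ?_⟩
  rw [hu, hv]
  exact (hC σ hσ).trans (le_abs_self C)

/-! ### The kernel x^p (y + x)^q and its Beta integral -/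

/-- The two-sided power kernel `x ^ p * (y + x) ^ q`. -/
noncomputable def powKernel (p q : ℂ) (y x : ℝ) : ℂ := (x : ℂ) ^ p * ((y + x : ℝ) : ℂ) ^ q

theorem norm_powKernel (p q : ℂ) {y x : ℝ} (hy : 0 ≤ y) (hx : 0 < x) :
    ‖powKernel p q y x‖ = x ^ p.re * (y + x) ^ q.re := by
  rw [powKernel, norm_mul, Complex.norm_cpow_eq_rpow_re_of_pos hx,
    Complex.norm_cpow_eq_rpow_re_of_pos (by linarith)]

/-- The substitution x/(1-x) carries (0, 1) onto (0, ∞) and, with its Jacobian, turns the kernel at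
y = 1 into a Beta integrand. -/
theorem powKernel_one_comp (p q : ℂ) {x : ℝ} (hx : x ∈ Ioo (0 : ℝ) 1) :
    |1 / (1 - x) ^ 2| • powKernel p q 1 (x / (1 - x)) =
      (x : ℂ) ^ (p + 1 - 1) * (1 - (x : ℂ)) ^ (-p - q - 1 - 1) := by
  have h1 : 0 < 1 - x := sub_pos.2 hx.2
  have h1' : ((1 - x : ℝ) : ℂ) ≠ 0 := by exact_mod_cast h1.ne'
  have e : 1 + x / (1 - x) = (1 - x)⁻¹ := by
    field_simp
    ring
  rw [powKernel, e, abs_of_pos (by positivity), Complex.real_smul, div_eq_mul_inv x,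
    add_sub_cancel_right,
    Complex.ofReal_mul, Complex.mul_cpow_ofReal_nonneg hx.1.le (by positivity),
    show (1 - (x : ℂ)) = ((1 - x : ℝ) : ℂ) by push_cast; rfl, Complex.ofReal_inv,
    Complex.inv_cpow _ _ (by
      rw [Complex.arg_ofReal_of_nonneg h1.le]
      exact Real.pi_pos.ne),
    Complex.inv_cpow _ _ (by
      rw [Complex.arg_ofReal_of_nonneg h1.le]
      exact Real.pi_pos.ne), ← Complex.cpow_neg, ← Complex.cpow_neg]
  have e2 : (-p - q - 1 - 1 : ℂ) = -p + -q + (-2 : ℤ) := by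
    push_cast
    ring
  rw [e2, Complex.cpow_add _ _ h1', Complex.cpow_add _ _ h1', Complex.cpow_intCast]
  push_cast
  rw [zpow_neg]
  simp only [one_div]
  norm_cast
  ring

theorem image_div_one_sub_Ioo : (fun x : ℝ => x / (1 - x)) '' Ioo 0 1 = Ioi 0 := by
  ext y
  constructor
  · rintro ⟨x, hx, rfl⟩
    exact div_pos hx.1 (sub_pos.2 hx.2)
  · intro hy
    have hy : 0 < y := hy
    have h1 : 0 < 1 + y := by linarith
    refine ⟨y / (1 + y), ⟨by positivity, (div_lt_one h1).2 (by linarith)⟩, ?_⟩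
    simp only
    field_simp
    ring

theorem injOn_div_one_sub : InjOn (fun x : ℝ => x / (1 - x)) (Ioo 0 1) := by
  intro x hx y hy hxy
  have h1 : 1 - x ≠ 0 := (sub_pos.2 hx.2).ne'
  have h2 : 1 - y ≠ 0 := (sub_pos.2 hy.2).ne'
  simp only at hxy
  rw [div_eq_div_iff h1 h2] at hxy
  linarith

theorem hasDerivAt_div_one_sub {x : ℝ} (hx : x ∈ Ioo (0 : ℝ) 1) :
    HasDerivAt (fun x : ℝ => x / (1 - x)) (1 / (1 - x) ^ 2) x := by
  have h1 : 1 - x ≠ 0 := (sub_pos.2 hx.2).ne'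
  refine ((hasDerivAt_id x).div ((hasDerivAt_id x).const_sub 1) h1).congr_deriv ?_
  simp

theorem integrableOn_powKernel_one {p q : ℂ} (hp : -1 < p.re) (hpq : p.re + q.re < -1) :
    IntegrableOn (powKernel p q 1) (Ioi 0) := by
  rw [← image_div_one_sub_Ioo, integrableOn_image_iff_integrableOn_abs_deriv_smul measurableSet_Ioo
    (fun x hx => (hasDerivAt_div_one_sub hx).hasDerivWithinAt) injOn_div_one_sub]
  rw [integrableOn_congr_fun (fun x hx => powKernel_one_comp p q hx) measurableSet_Ioo]
  have := Complex.betaIntegral_convergent (u := p + 1) (v := -p - q - 1) (by simp; linarith)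
    (by simp; linarith)
  rw [intervalIntegrable_iff_integrableOn_Ioo_of_le zero_le_one] at this
  exact this

/-- No convergence condition appears: the substitution preserves integrability, and divergent
integrals have the default value 0 on both sides. -/
theorem integral_powKernel_one (p q : ℂ) :
    ∫ x in Ioi (0 : ℝ), powKernel p q 1 x = Complex.betaIntegral (p + 1) (-p - q - 1) := by
  rw [← image_div_one_sub_Ioo, integral_image_eq_integral_abs_deriv_smul measurableSet_Ioo
    (fun x hx => (hasDerivAt_div_one_sub hx).hasDerivWithinAt) injOn_div_one_sub,
    setIntegral_congr_fun measurableSet_Ioo (fun x hx => powKernel_one_comp p q hx),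
    Complex.betaIntegral, intervalIntegral.integral_of_le zero_le_one,
    ← setIntegral_congr_set Ioo_ae_eq_Ioc]

/-- Homogeneity of degree p + q, which reduces every y > 0 to y = 1. -/
theorem powKernel_scale (p q : ℂ) {y x : ℝ} (hy : 0 < y) (hx : 0 < x) :
    powKernel p q y (y * x) = (y : ℂ) ^ (p + q) * powKernel p q 1 x := by
  have hy' : (y : ℂ) ≠ 0 := by exact_mod_cast hy.ne'
  rw [powKernel, powKernel, show y + y * x = y * (1 + x) by ring, Complex.ofReal_mul,
    Complex.ofReal_mul, Complex.mul_cpow_ofReal_nonneg hy.le hx.le,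
    Complex.mul_cpow_ofReal_nonneg hy.le (by positivity), Complex.cpow_add _ _ hy']
  ring

theorem integrableOn_powKernel {p q : ℂ} {y : ℝ} (hy : 0 < y) (hp : -1 < p.re)
    (hpq : p.re + q.re < -1) : IntegrableOn (powKernel p q y) (Ioi 0) := by
  rw [← mul_zero y, ← integrableOn_Ioi_comp_mul_left_iff _ _ hy]
  rw [integrableOn_congr_fun (fun x (hx : x ∈ Ioi (0 : ℝ)) => powKernel_scale p q hy hx)
    measurableSet_Ioi]
  exact (integrableOn_powKernel_one hp hpq).const_mul _

theorem integral_powKernel (p q : ℂ) {y : ℝ} (hy : 0 < y) :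
    ∫ x in Ioi (0 : ℝ), powKernel p q y x =
      (y : ℂ) ^ (p + q + 1) * Complex.betaIntegral (p + 1) (-p - q - 1) := by
  have hy' : (y : ℂ) ≠ 0 := by exact_mod_cast hy.ne'
  have h := integral_comp_mul_left_Ioi (powKernel p q y) 0 hy
  rw [setIntegral_congr_fun measurableSet_Ioi (fun x hx => powKernel_scale p q hy hx),
    integral_const_mul, integral_powKernel_one, mul_zero, Complex.real_smul] at h
  rw [Complex.cpow_add _ _ hy', Complex.cpow_one, mul_right_comm, h]
  push_cast
  field_simp

theorem integral_norm_powKernel (p q : ℂ) {y : ℝ} (hy : 0 < y) :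
    ∫ x in Ioi (0 : ℝ), ‖powKernel p q y x‖ =
      y ^ (p.re + q.re + 1) * ‖Complex.betaIntegral (p.re + 1) (-p.re - q.re - 1)‖ := by
  have h := integral_powKernel p.re q.re hy
  have e : ∫ x in Ioi (0 : ℝ), powKernel p.re q.re y x =
      ((∫ x in Ioi (0 : ℝ), ‖powKernel p q y x‖ : ℝ) : ℂ) := by
    rw [← integral_complex_ofReal]
    refine setIntegral_congr_fun measurableSet_Ioi fun x hx => ?_
    have hx : 0 < x := hx
    rw [norm_powKernel p q hy.le hx, powKernel]
    rw [Complex.ofReal_mul, Complex.ofReal_cpow hx.le, Complex.ofReal_cpow (by linarith)]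
  rw [e] at h
  have h' := congrArg norm h
  rw [Complex.norm_of_nonneg (integral_nonneg fun _ => norm_nonneg _), norm_mul,
    Complex.norm_cpow_eq_rpow_re_of_pos hy] at h'
  rw [h']
  simp

theorem continuousOn_powKernel {p q : ℂ} {y : ℝ} (hy : 0 < y) (hp : 0 < p.re) :
    ContinuousOn (powKernel p q y) (Ici 0) := by
  refine ContinuousOn.mul ?_ ?_
  · exact (Complex.continuous_ofReal_cpow_const hp).continuousOn
  · intro x hx
    have hx : 0 ≤ x := hx
    refine ContinuousAt.continuousWithinAt ?_
    have h1 : ContinuousAt (fun x : ℝ => ((y + x : ℝ) : ℂ)) x := by fun_prop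
    have h2 : ((y + x : ℝ) : ℂ) ∈ Complex.slitPlane := Or.inl (by simpa using by linarith)
    exact ContinuousAt.cpow h1 continuousAt_const h2

theorem powKernel_zero {p : ℂ} (q : ℂ) (y : ℝ) (hp : 0 < p.re) : powKernel p q y 0 = 0 := by
  have : p ≠ 0 := by
    rintro rfl
    simp at hp
  simp [powKernel, this]

theorem hasDerivAt_powKernel (p q : ℂ) {y x : ℝ} (hy : 0 < y) (hx : 0 < x) :
    HasDerivAt (powKernel p q y) (p * powKernel (p - 1) q y x + q * powKernel p (q - 1) y x) x := by
  have h1 : HasDerivAt (fun z : ℂ => z ^ p * ((y : ℂ) + z) ^ q)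
      ((p * (x : ℂ) ^ (p - 1) * 1) * ((y : ℂ) + x) ^ q +
        (x : ℂ) ^ p * (q * ((y : ℂ) + x) ^ (q - 1) * 1)) (x : ℂ) := by
    refine HasDerivAt.mul ?_ ?_
    · exact (hasDerivAt_id _).cpow_const (c := p) (Or.inl (by simpa using hx))
    · refine ((hasDerivAt_id _).const_add (y : ℂ)).cpow_const (c := q) (Or.inl ?_)
      simp
      linarith
  have h2 := h1.comp_ofReal
  have e : powKernel p q y = fun x : ℝ => (x : ℂ) ^ p * ((y : ℂ) + x) ^ q := by
    funext x
    simp [powKernel]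
  rw [e]
  refine h2.congr_deriv ?_
  simp only [powKernel, Complex.ofReal_add]
  ring

/-- For `σ` in `[a, b]`, the weight `x ^ (p - σ) * (y + x) ^ (q - σ)` is at most the sum of the
weights at the two ends. -/
theorem rpow_mul_rpow_le_add {p q a b σ x y : ℝ} (hσ : σ ∈ Icc a b) (hx : 0 < x) (hy : 0 < y) :
    x ^ (p - σ) * (y + x) ^ (q - σ) ≤
      x ^ (p - a) * (y + x) ^ (q - a) + x ^ (p - b) * (y + x) ^ (q - b) := by
  have hxy : 0 < y + x := by linarith
  -- All dependence on the exponent sits in (x(y+x))^(-τ), which is monotone in τ, in a direction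
  -- decided by whether the base exceeds 1.
  have key : ∀ τ : ℝ, x ^ (p - τ) * (y + x) ^ (q - τ) =
      x ^ p * (y + x) ^ q * (x * (y + x)) ^ (-τ) := fun τ => by
    rw [Real.mul_rpow hx.le hxy.le, sub_eq_add_neg, sub_eq_add_neg, Real.rpow_add hx,
      Real.rpow_add hxy]
    ring
  rw [key, key, key, ← mul_add]
  refine mul_le_mul_of_nonneg_left ?_ (by positivity)
  have hb : 0 < x * (y + x) := by positivity
  rcases le_total 1 (x * (y + x)) with h | h
  · refine (Real.rpow_le_rpow_of_exponent_le h (neg_le_neg hσ.1)).trans ?_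
    exact le_add_of_nonneg_right (by positivity)
  · refine (Real.rpow_le_rpow_of_exponent_ge hb h (neg_le_neg hσ.2)).trans ?_
    exact le_add_of_nonneg_left (by positivity)

/-! ### Bernoulli remainder integrals, their series in j, and continuation by parts -/

/-- The Bernoulli remainder integral with kernel `x ^ (p - s) * (y + x) ^ (q - s)`. -/
noncomputable def bernoulliIntegral (l : ℕ) (p q : ℝ) (y : ℝ) (s : ℂ) : ℂ :=
  ∫ x in Ioi (0 : ℝ), (perBernoulli l x : ℂ) * powKernel (p - s) (q - s) y x

theorem measurable_powKernel (p q : ℂ) (y : ℝ) : Measurable (powKernel p q y) := by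
  unfold powKernel
  fun_prop

theorem differentiable_powKernel (p q : ℂ) {y x : ℝ} (hy : 0 < y) (hx : 0 < x) :
    Differentiable ℂ fun s => powKernel (p - s) (q - s) y x := by
  have hx' : (x : ℂ) ≠ 0 := by exact_mod_cast hx.ne'
  have hxy : ((y + x : ℝ) : ℂ) ≠ 0 := by exact_mod_cast (by linarith : y + x ≠ 0)
  exact ((differentiable_id.const_sub p).const_cpow (Or.inl hx')).mul
    ((differentiable_id.const_sub q).const_cpow (Or.inl hxy))

theorem differentiableOn_bernoulliIntegral (l : ℕ) (p q : ℝ) {y : ℝ} (hy : 0 < y) {a b : ℝ}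
    (ha : p + q - 2 * a ≤ -1) (hb : -1 ≤ p - b) :
    DifferentiableOn ℂ (bernoulliIntegral l p q y) (Complex.re ⁻¹' Ioo a b) := by
  obtain ⟨C, hC0, hC⟩ := exists_abs_perBernoulli_le l
  refine differentiableOn_integral_of_local_bound (isOpen_re_preimage_Ioo a b) (fun s _ => ?_)
    ?_ fun s hs => ?_
  · exact ((Complex.measurable_ofReal.comp (measurable_perBernoulli l)).mul
      (measurable_powKernel _ _ _)).aestronglyMeasurable
  · filter_upwards [ae_restrict_mem measurableSet_Ioi] with x hx
    exact ((differentiable_powKernel p q hy hx).const_mul _).differentiableOn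
  -- On a strictly narrower strip the kernels at both ends are integrable, and their sum is the
  -- dominating function.
  · obtain ⟨a', haa', has⟩ := exists_between hs.1
    obtain ⟨b', hsb, hbb'⟩ := exists_between hs.2
    have ha'b' : a' < b' := has.trans hsb
    have i1 : IntegrableOn (powKernel (p - a' : ℝ) (q - a' : ℝ) y) (Ioi 0) :=
      integrableOn_powKernel hy (by simp only [Complex.ofReal_re]; linarith)
        (by simp only [Complex.ofReal_re]; linarith)
    have i2 : IntegrableOn (powKernel (p - b' : ℝ) (q - b' : ℝ) y) (Ioi 0) :=
      integrableOn_powKernel hy (by simp only [Complex.ofReal_re]; linarith)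
        (by simp only [Complex.ofReal_re]; linarith)
    refine ⟨Complex.re ⁻¹' Ioo a' b', (isOpen_re_preimage_Ioo a' b').mem_nhds ⟨has, hsb⟩, _,
      (i1.norm.add i2.norm).const_mul C, ?_⟩
    filter_upwards [ae_restrict_mem measurableSet_Ioi] with x hx w hw
    have hx : 0 < x := hx
    rw [norm_mul, Complex.norm_real]
    refine mul_le_mul (hC x) ?_ (norm_nonneg _) hC0
    simp only [Pi.add_apply]
    rw [norm_powKernel _ _ hy.le hx, norm_powKernel _ _ hy.le hx, norm_powKernel _ _ hy.le hx]
    simpa using rpow_mul_rpow_le_add (p := p) (q := q) ⟨hw.1.le, hw.2.le⟩ hx hy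

/-- The remainder integral, on a closed strip. -/
theorem exists_norm_bernoulliIntegral_le (l : ℕ) (p q : ℝ) {a b : ℝ}
    (ha : p + q - 2 * a < -1) (hb : -1 < p - b) :
    ∃ C, 0 ≤ C ∧ ∀ s : ℂ, s.re ∈ Icc a b → ∀ y : ℝ, 0 < y →
      ‖bernoulliIntegral l p q y s‖ ≤ C * y ^ (p + q + 1 - 2 * s.re) := by
  obtain ⟨C, hC0, hC⟩ := exists_abs_perBernoulli_le l
  obtain ⟨B, hB0, hB⟩ := exists_norm_betaIntegral_le (a := a) (b := b) (m := -1) (c := p + 1)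
    (m' := 2) (c' := -p - q - 1) fun σ hσ => ⟨by linarith [hσ.2], by linarith [hσ.1]⟩
  refine ⟨C * B, by positivity, fun s hs y hy => ?_⟩
  have hi : IntegrableOn (powKernel (p - s) (q - s) y) (Ioi 0) :=
    integrableOn_powKernel hy (by simp; linarith [hs.2]) (by simp; linarith [hs.1])
  have h1 : ‖bernoulliIntegral l p q y s‖ ≤
      ∫ x in Ioi (0 : ℝ), C * ‖powKernel (p - s) (q - s) y x‖ := by
    refine norm_integral_le_of_norm_le (hi.norm.const_mul C) (Eventually.of_forall fun x => ?_)
    rw [norm_mul, Complex.norm_real]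
    exact mul_le_mul_of_nonneg_right (hC x) (norm_nonneg _)
  rw [integral_const_mul, integral_norm_powKernel _ _ hy] at h1
  refine h1.trans ?_
  rw [mul_assoc]
  refine mul_le_mul_of_nonneg_left ?_ hC0
  rw [mul_comm]
  refine mul_le_mul (hB s.re hs _ _ ?_ ?_) (le_of_eq ?_) (by positivity) hB0
  · simp
    ring
  · simp
    ring
  · congr 1
    simp
    ring

theorem summable_pnat_rpow {r : ℝ} (hr : r < -1) : Summable fun j : ℕ+ => (j : ℝ) ^ r :=
  (Real.summable_nat_rpow.2 hr).comp_injective PNat.coe_injective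

theorem norm_pnat_cpow (j : ℕ+) (s : ℂ) : ‖(j : ℂ) ^ s‖ = (j : ℝ) ^ s.re :=
  Complex.norm_natCast_cpow_of_pos j.pos s

/-- The series of Bernoulli remainders with weights `j ^ (a - s)`. -/
noncomputable def bernoulliSeries (l : ℕ) (a p q : ℝ) (s : ℂ) : ℂ :=
  ∑' j : ℕ+, (j : ℂ) ^ (a - s) * bernoulliIntegral l p q j s

theorem exists_bound_bernoulliSeries_term (l : ℕ) (a p q : ℝ) {α β : ℝ}
    (h1 : p + q - 2 * α < -1) (h2 : -1 < p - β) (h3 : a + p + q + 1 - 3 * α < -1) :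
    ∃ v : ℕ+ → ℝ, Summable v ∧ ∀ j : ℕ+, ∀ s : ℂ, s.re ∈ Icc α β →
      ‖(j : ℂ) ^ (a - s) * bernoulliIntegral l p q j s‖ ≤ v j := by
  obtain ⟨C, hC0, hC⟩ := exists_norm_bernoulliIntegral_le l p q h1 h2
  refine ⟨fun j => C * (j : ℝ) ^ (a + p + q + 1 - 3 * α), (summable_pnat_rpow h3).mul_left C,
    fun j s hs => ?_⟩
  have hj : (0 : ℝ) < j := by exact_mod_cast j.pos
  have hj1 : (1 : ℝ) ≤ j := by exact_mod_cast j.pos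
  rw [norm_mul, norm_pnat_cpow]
  calc (j : ℝ) ^ ((a : ℂ) - s).re * ‖bernoulliIntegral l p q j s‖
      ≤ (j : ℝ) ^ ((a : ℂ) - s).re * (C * (j : ℝ) ^ (p + q + 1 - 2 * s.re)) :=
        mul_le_mul_of_nonneg_left (hC s hs j hj) (by positivity)
    _ = C * (j : ℝ) ^ (a + p + q + 1 - 3 * s.re) := by
        rw [mul_left_comm, ← Real.rpow_add hj]
        congr 2
        simp
        ring
    _ ≤ _ := mul_le_mul_of_nonneg_left
        (Real.rpow_le_rpow_of_exponent_le hj1 (by linarith [hs.1])) hC0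

theorem summable_bernoulliSeries_term (l : ℕ) (a p q : ℝ) {s : ℂ}
    (h1 : p + q - 2 * s.re < -1) (h2 : -1 < p - s.re) (h3 : a + p + q + 1 - 3 * s.re < -1) :
    Summable fun j : ℕ+ => (j : ℂ) ^ (a - s) * bernoulliIntegral l p q j s := by
  obtain ⟨v, hv, hb⟩ := exists_bound_bernoulliSeries_term l a p q h1 h2 h3
  exact Summable.of_norm_bounded hv fun j => hb j s ⟨le_rfl, le_rfl⟩

theorem differentiableOn_bernoulliSeries (l : ℕ) (a p q : ℝ) {α β : ℝ}
    (h1 : p + q - 2 * α ≤ -1) (h2 : -1 ≤ p - β) (h3 : a + p + q + 1 - 3 * α ≤ -1) :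
    DifferentiableOn ℂ (bernoulliSeries l a p q) (Complex.re ⁻¹' Ioo α β) := by
  refine differentiableOn_tsum_of_local_bound (fun j => ?_) fun s hs => ?_
  · have hj : (0 : ℝ) < j := by exact_mod_cast j.pos
    refine DifferentiableOn.mul (Differentiable.differentiableOn ?_)
      (differentiableOn_bernoulliIntegral l p q hj h1 h2)
    exact (differentiable_id.const_sub _).const_cpow (Or.inl (by exact_mod_cast j.ne_zero))
  · obtain ⟨α', hα, hα'⟩ := exists_between hs.1
    obtain ⟨β', hβ', hβ⟩ := exists_between hs.2
    obtain ⟨v, hv, hb⟩ := exists_bound_bernoulliSeries_term l a p q (α := α') (β := β')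
      (by linarith) (by linarith) (by linarith)
    exact ⟨Complex.re ⁻¹' Ioo α' β', isOpen_re_preimage_Ioo _ _,
      fun w hw => ⟨hα.trans hw.1, hw.2.trans hβ⟩, ⟨hα', hβ'⟩, v, hv,
      fun j w hw => hb j w ⟨hw.1.le, hw.2.le⟩⟩

theorem polyGrowth_bernoulliSeries (l : ℕ) (a p q : ℝ) {α β : ℝ}
    (h1 : p + q - 2 * α < -1) (h2 : -1 < p - β) (h3 : a + p + q + 1 - 3 * α < -1) :
    PolyGrowth (bernoulliSeries l a p q) (Complex.re ⁻¹' Icc α β) := by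
  obtain ⟨v, hv, hb⟩ := exists_bound_bernoulliSeries_term l a p q h1 h2 h3
  exact PolyGrowth.of_bounded (C := ∑' j, v j) fun s hs _ =>
    tsum_of_norm_bounded hv.hasSum fun j => hb j s hs

theorem integral_perBernoulli_mul_deriv_powKernel (l : ℕ) {p q y : ℝ} {s : ℂ} (hy : 0 < y)
    (hp : 0 < p - s.re) (hpq : p + q - 2 * s.re < -1) :
    ∫ x in Ioi (0 : ℝ), (perBernoulli l x : ℂ) *
        ((p - s) * powKernel (p - s - 1) (q - s) y x +
          (q - s) * powKernel (p - s) (q - s - 1) y x) =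
      (p - s) * bernoulliIntegral l (p - 1) q y s + (q - s) * bernoulliIntegral l p (q - 1) y s := by
  have i1 : IntegrableOn (powKernel ((p - 1 : ℝ) - s) (q - s) y) (Ioi 0) :=
    integrableOn_powKernel hy (by simp; linarith) (by simp; linarith)
  have i2 : IntegrableOn (powKernel (p - s) ((q - 1 : ℝ) - s) y) (Ioi 0) :=
    integrableOn_powKernel hy (by simp; linarith) (by simp; linarith)
  rw [bernoulliIntegral, bernoulliIntegral, ← integral_const_mul, ← integral_const_mul,
    ← integral_add ((i1.perBernoulli_mul l).const_mul _) ((i2.perBernoulli_mul l).const_mul _)]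
  refine integral_congr_ae (Eventually.of_forall fun x => ?_)
  have e1 : (((p - 1 : ℝ) : ℂ) - s) = p - s - 1 := by push_cast; ring
  have e2 : (((q - 1 : ℝ) : ℂ) - s) = q - s - 1 := by push_cast; ring
  simp only [e1, e2]
  ring

theorem integrableOn_deriv_powKernel {p q y : ℝ} {s : ℂ} (hy : 0 < y)
    (hp : 0 < p - s.re) (hpq : p + q - 2 * s.re < -1) :
    IntegrableOn (fun x => (p - s) * powKernel (p - s - 1) (q - s) y x +
          (q - s) * powKernel (p - s) (q - s - 1) y x) (Ioi 0) :=
  ((integrableOn_powKernel hy (by simp; linarith) (by simp; linarith)).const_mul _).add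
    ((integrableOn_powKernel hy (by simp; linarith) (by simp; linarith)).const_mul _)

theorem bernoulliIntegral_by_parts {l : ℕ} (hl : l ≠ 0) {p q y : ℝ} {s : ℂ} (hy : 0 < y)
    (hp : 0 < p - s.re) (hpq : p + q - 2 * s.re < -1) :
    bernoulliIntegral l p q y s = -((p - s) * bernoulliIntegral (l + 1) (p - 1) q y s +
      (q - s) * bernoulliIntegral (l + 1) p (q - 1) y s) := by
  have hp' : 0 < ((p : ℂ) - s).re := by simpa using hp
  rw [← integral_perBernoulli_mul_deriv_powKernel (l + 1) hy hp hpq]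
  exact integral_perBernoulli_mul_by_parts hl (continuousOn_powKernel hy hp')
    (powKernel_zero _ _ hp') (fun x hx => hasDerivAt_powKernel _ _ hy hx)
    (integrableOn_powKernel hy (by simp; linarith) (by simp; linarith))
    (integrableOn_deriv_powKernel hy hp hpq)

/-- Each integration by parts lowers p + q by one and so gains a power of j in the sum; the price is
weaker vanishing at x = 0 when the derivative falls on x^(p-s). -/
theorem bernoulliSeries_by_parts {l : ℕ} (hl : l ≠ 0) {a p q : ℝ} {s : ℂ}
    (h1 : p + q - 2 * s.re < -1) (h2 : 0 < p - s.re) (h3 : a + p + q + 1 - 3 * s.re < -1) :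
    bernoulliSeries l a p q s = -((p - s) * bernoulliSeries (l + 1) a (p - 1) q s +
      (q - s) * bernoulliSeries (l + 1) a p (q - 1) s) := by
  have s1 := summable_bernoulliSeries_term (l + 1) a (p - 1) q (s := s) (by linarith) (by linarith)
    (by linarith)
  have s2 := summable_bernoulliSeries_term (l + 1) a p (q - 1) (s := s) (by linarith) (by linarith)
    (by linarith)
  rw [bernoulliSeries, bernoulliSeries, bernoulliSeries, ← tsum_mul_left, ← tsum_mul_left,
    ← (s1.mul_left _).tsum_add (s2.mul_left _), ← tsum_neg]
  refine tsum_congr fun j => ?_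
  rw [bernoulliIntegral_by_parts hl (by exact_mod_cast j.pos) h2 h1]
  ring

/-- Repeated integration by parts continues the Bernoulli remainder series to the left. -/
theorem exists_continuation_bernoulliSeries (a : ℝ) (r : ℕ) : ∀ (l : ℕ), l ≠ 0 → ∀ p q : ℝ,
    ∃ E : ℂ → ℂ,
      (∀ α β : ℝ, p + q - r - 2 * α ≤ -1 → -1 ≤ p - r - β → a + p + q + 1 - r - 3 * α ≤ -1 →
        DifferentiableOn ℂ E (Complex.re ⁻¹' Ioo α β)) ∧
      (∀ α β : ℝ, p + q - r - 2 * α < -1 → -1 < p - r - β → a + p + q + 1 - r - 3 * α < -1 →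
        PolyGrowth E (Complex.re ⁻¹' Icc α β)) ∧
      ∀ s : ℂ, p + q - 2 * s.re < -1 → r - 1 < p - s.re → a + p + q + 1 - 3 * s.re < -1 →
        E s = bernoulliSeries l a p q s := by
  induction r with
  | zero =>
    intro l _ p q
    simp only [Nat.cast_zero, sub_zero, zero_sub]
    exact ⟨bernoulliSeries l a p q, fun α β => differentiableOn_bernoulliSeries l a p q,
      fun α β => polyGrowth_bernoulliSeries l a p q, fun _ _ _ _ => rfl⟩
  | succ r ih =>
    intro l hl p q
    -- The two terms of the product rule are continued separately. At worst all r derivatives fall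
    -- on the factor with exponent p, hence p - r in the conditions.
    obtain ⟨E₁, hd₁, hg₁, he₁⟩ := ih (l + 1) l.succ_ne_zero (p - 1) q
    obtain ⟨E₂, hd₂, hg₂, he₂⟩ := ih (l + 1) l.succ_ne_zero p (q - 1)
    refine ⟨fun s => -((p - s) * E₁ s + (q - s) * E₂ s), fun α β h1 h2 h3 => ?_,
      fun α β h1 h2 h3 => ?_, fun s h1 h2 h3 => ?_⟩
    · push_cast at h1 h2 h3
      have d₁ := hd₁ α β (by linarith) (by linarith) (by linarith)
      have d₂ := hd₂ α β (by linarith) (by linarith) (by linarith)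
      fun_prop
    · push_cast at h1 h2 h3
      have g₁ := hg₁ α β (by linarith) (by linarith) (by linarith)
      have g₂ := hg₂ α β (by linarith) (by linarith) (by linarith)
      have hid := PolyGrowth.id_strip α β
      exact ((((PolyGrowth.const _).sub hid).mul g₁).add
        (((PolyGrowth.const _).sub hid).mul g₂)).neg
    · push_cast at h2
      have hr : (0 : ℝ) ≤ r := by positivity
      simp only
      rw [he₁ s (by linarith) (by linarith) (by linarith),
        he₂ s (by linarith) (by linarith) (by linarith),
        bernoulliSeries_by_parts hl h1 (by linarith) h3]

/-- Euler–Maclaurin in k: p > Re s makes the kernel vanish at 0, so there is no boundary term. -/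
theorem tsum_powKernel {p q y : ℝ} {s : ℂ} (hy : 0 < y)
    (hp : 0 < p - s.re) (hpq : p + q - 2 * s.re < -1)
    (hs : Summable fun k : ℕ+ => powKernel (p - s) (q - s) y k) :
    ∑' k : ℕ+, powKernel (p - s) (q - s) y k =
      (y : ℂ) ^ (p + q + 1 - 2 * s) *
        Complex.betaIntegral (p - s + 1) (2 * s - p - q - 1) +
      ((p - s) * bernoulliIntegral 1 (p - 1) q y s +
        (q - s) * bernoulliIntegral 1 p (q - 1) y s) := by
  have hp' : 0 < ((p : ℂ) - s).re := by simpa using hp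
  have h := tendsto_sum_eq_integral_add (continuousOn_powKernel hy hp')
    (powKernel_zero _ _ hp') (fun x hx => hasDerivAt_powKernel (p - s) (q - s) hy hx)
    (integrableOn_powKernel hy (by simp; linarith) (by simp; linarith))
    (integrableOn_deriv_powKernel hy hp hpq)
  rw [integral_perBernoulli_mul_deriv_powKernel 1 hy hp hpq, integral_powKernel _ _ hy] at h
  have e1 : (p - s + (q - s) + 1 : ℂ) = p + q + 1 - 2 * s := by ring
  have e2 : (-(p - s) - (q - s) - 1 : ℂ) = 2 * s - p - q - 1 := by ring
  rw [e1, e2] at h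
  refine tendsto_nhds_unique ?_ h
  have hs' := (Equiv.pnatEquivNat.symm.summable_iff (f := fun k : ℕ+ =>
    powKernel (p - s) (q - s) y k)).2 hs
  rw [← Equiv.pnatEquivNat.symm.tsum_eq]
  refine hs'.hasSum.tendsto_sum_nat.congr fun n => Finset.sum_congr rfl fun k _ => ?_
  simp [Equiv.pnatEquivNat]

/-- The weighted double series as a main term and two Bernoulli remainder series. -/
theorem tsum_pow_mul_powKernel {a p q : ℝ} {s : ℂ} (hapq : a + p + q = 0)
    (hp : 0 < p - s.re) (hpq : p + q - 2 * s.re < -1) (hs3 : 2 / 3 < s.re)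
    (hs : Summable fun z : ℕ+ × ℕ+ => (z.1 : ℂ) ^ (a - s) * powKernel (p - s) (q - s) z.1 z.2) :
    ∑' z : ℕ+ × ℕ+, (z.1 : ℂ) ^ (a - s) * powKernel (p - s) (q - s) z.1 z.2 =
      riemannZeta (3 * s - 1) * Complex.betaIntegral (p - s + 1) (2 * s - p - q - 1) +
      ((p - s) * bernoulliSeries 1 a (p - 1) q s + (q - s) * bernoulliSeries 1 a p (q - 1) s) := by
  have hz : HasSum (fun j : ℕ+ => (j : ℂ) ^ (1 - 3 * s)) (riemannZeta (3 * s - 1)) := by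
    have h := hasSum_nat_add_one_cpow (s := 3 * s - 1) (by simp; linarith)
    rw [← Equiv.pnatEquivNat.symm.hasSum_iff]
    refine h.congr_fun fun n => ?_
    simp [Equiv.pnatEquivNat]
  have s1 := summable_bernoulliSeries_term 1 a (p - 1) q (s := s) (by linarith) (by linarith)
    (by linarith)
  have s2 := summable_bernoulliSeries_term 1 a p (q - 1) (s := s) (by linarith) (by linarith)
    (by linarith)
  rw [hs.tsum_prod, bernoulliSeries, bernoulliSeries, ← hz.tsum_eq, ← tsum_mul_right,
    ← tsum_mul_left, ← tsum_mul_left, ← (s1.mul_left _).tsum_add (s2.mul_left _),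
    ← (hz.summable.mul_right _).tsum_add ((s1.mul_left _).add (s2.mul_left _))]
  refine tsum_congr fun j => ?_
  have hj : (0 : ℝ) < j := by exact_mod_cast j.pos
  have hj0 : (j : ℂ) ≠ 0 := by exact_mod_cast j.ne_zero
  have hjs : Summable fun k : ℕ+ => powKernel (p - s) (q - s) j k := by
    have h : Summable fun k : ℕ+ => (j : ℂ) ^ (a - s) * powKernel (p - s) (q - s) j k :=
      hs.prod_factor j
    have hne : (j : ℂ) ^ (a - s) ≠ 0 := fun h => hj0 ((Complex.cpow_eq_zero_iff _ _).1 h).1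
    exact (summable_mul_left_iff hne).1 h
  dsimp only
  rw [tsum_mul_left, tsum_powKernel hj hp hpq hjs]
  -- Because a + p + q = 0, the power of j in the main term does not depend on the splitting, and
  -- its sum is always ζ(3s-1).
  have e : (j : ℂ) ^ (1 - 3 * s) = (j : ℂ) ^ (a - s) * (j : ℂ) ^ (p + q + 1 - 2 * s) := by
    rw [← Complex.cpow_add _ _ hj0]
    congr 1
    have : (a + p + q : ℂ) = 0 := by exact_mod_cast hapq
    linear_combination -this
  rw [e]
  push_cast
  ring

/-! ### Convergence and holomorphy of the double series -/

theorem omegaTerm_eq (s : ℂ) (z : ℕ+ × ℕ+) :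
    omegaTerm s z = (((z.1 * z.2 * (z.1 + z.2) : ℕ+) : ℕ) : ℂ) ^ (-s) := by
  rw [omegaTerm, Complex.cpow_neg, one_div]
  push_cast
  rfl

theorem norm_omegaTerm (s : ℂ) (z : ℕ+ × ℕ+) :
    ‖omegaTerm s z‖ = ((z.1 : ℝ) * z.2 * (z.1 + z.2)) ^ (-s.re) := by
  rw [omegaTerm_eq, norm_pnat_cpow]
  push_cast
  rfl

theorem pnat_cast_pos (j : ℕ+) : (0 : ℝ) < j := by exact_mod_cast j.pos

theorem one_le_pnat_cast (j : ℕ+) : (1 : ℝ) ≤ j := by exact_mod_cast j.pos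

theorem one_le_omegaBase (z : ℕ+ × ℕ+) : (1 : ℝ) ≤ (z.1 : ℝ) * z.2 * (z.1 + z.2) := by
  have h1 := one_le_pnat_cast z.1
  have h2 := one_le_pnat_cast z.2
  have h3 : (1 : ℝ) ≤ (z.1 : ℝ) * z.2 := one_le_mul_of_one_le_of_one_le h1 h2
  exact one_le_mul_of_one_le_of_one_le h3 (by linarith)

/-- From j + k ≥ √(jk) the base is at least (jk)^(3/2), and the resulting majorant is a product of
two series with exponent 3σ/2 > 1. -/
theorem summable_omegaBase_rpow {σ : ℝ} (hσ : 2 / 3 < σ) :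
    Summable fun z : ℕ+ × ℕ+ => ((z.1 : ℝ) * z.2 * (z.1 + z.2)) ^ (-σ) := by
  have h1 := summable_pnat_rpow (r := -(3 / 2 * σ)) (by linarith)
  have h2 := h1.mul_of_nonneg h1 (fun j => by positivity) (fun j => by positivity)
  refine Summable.of_nonneg_of_le (fun z => by positivity) (fun z => ?_) h2
  have hj := pnat_cast_pos z.1
  have hk := pnat_cast_pos z.2
  rw [← Real.mul_rpow hj.le hk.le, show -(3 / 2 * σ) = 3 / 2 * (-σ) by ring,
    Real.rpow_mul (by positivity)]
  refine Real.rpow_le_rpow_of_nonpos (by positivity) ?_ (by linarith)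
  have e : ((z.1 : ℝ) * z.2) ^ (3 / 2 : ℝ) = (z.1 : ℝ) * z.2 * √((z.1 : ℝ) * z.2) := by
    rw [Real.sqrt_eq_rpow, show (3 / 2 : ℝ) = 1 + 1 / 2 by norm_num,
      Real.rpow_add (by positivity), Real.rpow_one]
  rw [e]
  refine mul_le_mul_of_nonneg_left ?_ (by positivity)
  rw [Real.sqrt_le_left (by positivity)]
  nlinarith

/-- As the base is at least 1, divergence need only be seen at exponent 2/3. The terms with k ≤ j
have base at most 2j³, so the inner sum is at least a constant times j · j⁻², the harmonic series.
-/
theorem summable_omegaTerm_iff (s : ℂ) : Summable (omegaTerm s) ↔ 2 / 3 < s.re := by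
  rw [← summable_norm_iff]
  simp only [norm_omegaTerm]
  refine ⟨fun h => ?_, summable_omegaBase_rpow⟩
  by_contra! hs
  have h1 : Summable fun z : ℕ+ × ℕ+ => ((z.1 : ℝ) * z.2 * (z.1 + z.2)) ^ (-(2 / 3) : ℝ) :=
    Summable.of_nonneg_of_le (fun z => by positivity)
      (fun z => Real.rpow_le_rpow_of_exponent_le (one_le_omegaBase z) (by linarith)) h
  have h2 := h1.prod
  have h3 : Summable fun j : ℕ+ => (2 : ℝ) ^ (-(2 / 3) : ℝ) * (j : ℝ)⁻¹ := by
    refine Summable.of_nonneg_of_le (fun j => by positivity) (fun j => ?_) h2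
    have hj := pnat_cast_pos j
    refine le_trans ?_ ((h1.prod_factor j).sum_le_tsum (Finset.Icc 1 j) fun k _ => by positivity)
    have hle : ∀ k ∈ Finset.Icc 1 j, (2 : ℝ) ^ (-(2 / 3) : ℝ) * ((j : ℝ) ^ 2)⁻¹ ≤
        ((j : ℝ) * k * (j + k)) ^ (-(2 / 3) : ℝ) := fun k hk => by
      have hkj : (k : ℝ) ≤ j := by exact_mod_cast (Finset.mem_Icc.1 hk).2
      have hk0 := pnat_cast_pos k
      have e : ((j : ℝ) ^ 2)⁻¹ = ((j : ℝ) ^ 3) ^ (-(2 / 3) : ℝ) := by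
        rw [← Real.rpow_natCast, ← Real.rpow_natCast, ← Real.rpow_mul hj.le, ← Real.rpow_neg hj.le]
        norm_num
      rw [e, ← Real.mul_rpow (by norm_num) (by positivity)]
      refine Real.rpow_le_rpow_of_nonpos (by positivity) ?_ (by norm_num)
      calc (j : ℝ) * k * (j + k) ≤ j * j * (j + j) := by gcongr
        _ = 2 * (j : ℝ) ^ 3 := by ring
    refine le_trans (le_of_eq ?_) (Finset.card_nsmul_le_sum _ _ _ hle)
    have hcard : (Finset.Icc 1 j).card = (j : ℕ) := by
      simp [PNat.card_Icc]
    rw [hcard, nsmul_eq_mul]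
    field_simp
  have h4 := (summable_mul_left_iff (by positivity)).1 h3
  have h5 := (Equiv.pnatEquivNat.symm.summable_iff (f := fun j : ℕ+ => (j : ℝ)⁻¹)).2 h4
  refine Real.not_summable_natCast_inv ((summable_nat_add_iff 1).1 (h5.congr fun n => ?_))
  simp [Equiv.pnatEquivNat]

theorem differentiableOn_omegaSeries : DifferentiableOn ℂ omegaSeries {s : ℂ | 2 / 3 < s.re} := by
  refine differentiableOn_tsum_of_local_bound (fun z => ?_) fun s hs => ?_
  · have e : (fun s => omegaTerm s z) =
        fun s => (((z.1 * z.2 * (z.1 + z.2) : ℕ+) : ℕ) : ℂ) ^ (-s) := by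
      funext s
      exact omegaTerm_eq s z
    rw [e]
    exact (differentiable_id.neg.const_cpow
      (Or.inl (by exact_mod_cast PNat.ne_zero _))).differentiableOn
  · obtain ⟨c, hc, hcs⟩ := exists_between (show (2 / 3 : ℝ) < s.re from hs)
    refine ⟨{w | c < w.re}, isOpen_lt continuous_const Complex.continuous_re,
      fun w hw => hc.trans hw, hcs, _, summable_omegaBase_rpow hc, fun z w hw => ?_⟩
    rw [norm_omegaTerm]
    exact Real.rpow_le_rpow_of_exponent_le (one_le_omegaBase z) (neg_le_neg (le_of_lt hw))

theorem exists_norm_omegaSeries_le {c : ℝ} (hc : 2 / 3 < c) :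
    ∃ C, ∀ s : ℂ, c ≤ s.re → ‖omegaSeries s‖ ≤ C := by
  refine ⟨_, fun s hs => tsum_of_norm_bounded (summable_omegaBase_rpow hc).hasSum fun z => ?_⟩
  rw [norm_omegaTerm]
  exact Real.rpow_le_rpow_of_exponent_le (one_le_omegaBase z) (neg_le_neg hs)

/-! ### Binomial splitting, its Beta main term and its remainder -/

/-- The `i`-th term of the binomial splitting of the summand of `ω` along
`1 = (j / (j + k) + k / (j + k)) ^ K`, without the binomial coefficient. -/
noncomputable def splitTerm (K i : ℕ) (s : ℂ) (z : ℕ+ × ℕ+) : ℂ :=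
  omegaTerm s z * ((z.1 : ℂ) ^ i * (z.2 : ℂ) ^ (K - i) / ((z.1 : ℂ) + z.2) ^ K)

theorem pnat_add_ne_zero (z : ℕ+ × ℕ+) : (z.1 : ℂ) + z.2 ≠ 0 := by
  exact_mod_cast (z.1 + z.2).ne_zero

theorem sum_choose_mul_splitTerm (K : ℕ) (s : ℂ) (z : ℕ+ × ℕ+) :
    ∑ i ∈ Finset.range (K + 1), (K.choose i : ℂ) * splitTerm K i s z = omegaTerm s z := by
  have h := add_pow (z.1 : ℂ) z.2 K
  have hne := pow_ne_zero K (pnat_add_ne_zero z)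
  calc ∑ i ∈ Finset.range (K + 1), (K.choose i : ℂ) * splitTerm K i s z
      = omegaTerm s z * ((∑ i ∈ Finset.range (K + 1),
          (z.1 : ℂ) ^ i * (z.2 : ℂ) ^ (K - i) * K.choose i) / ((z.1 : ℂ) + z.2) ^ K) := by
        rw [Finset.sum_div, Finset.mul_sum]
        refine Finset.sum_congr rfl fun i _ => ?_
        rw [splitTerm]
        ring
    _ = omegaTerm s z := by rw [← h, div_self hne, mul_one]

theorem splitTerm_swap {K i : ℕ} (hi : i ≤ K) (s : ℂ) (z : ℕ+ × ℕ+) :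
    splitTerm K (K - i) s z = splitTerm K i s z.swap := by
  rw [splitTerm, splitTerm, Nat.sub_sub_self hi, omegaTerm, omegaTerm]
  simp only [Prod.fst_swap, Prod.snd_swap]
  rw [add_comm (z.2 : ℂ) z.1, mul_comm (z.2 : ℂ) z.1, mul_comm ((z.2 : ℂ) ^ i)]

theorem norm_splitTerm_le {K i : ℕ} (hi : i ≤ K) (s : ℂ) (z : ℕ+ × ℕ+) :
    ‖splitTerm K i s z‖ ≤ ‖omegaTerm s z‖ := by
  have hj := pnat_cast_pos z.1
  have hk := pnat_cast_pos z.2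
  rw [splitTerm, norm_mul]
  refine mul_le_of_le_one_right (norm_nonneg _) ?_
  have e : ‖(z.1 : ℂ) ^ i * (z.2 : ℂ) ^ (K - i) / ((z.1 : ℂ) + z.2) ^ K‖ =
      (z.1 : ℝ) ^ i * (z.2 : ℝ) ^ (K - i) / ((z.1 : ℝ) + z.2) ^ K := by
    rw [norm_div, norm_mul, norm_pow, norm_pow, norm_pow, Complex.norm_natCast,
      Complex.norm_natCast]
    have : ‖(z.1 : ℂ) + z.2‖ = (z.1 : ℝ) + z.2 := by
      exact_mod_cast Complex.norm_natCast ((z.1 : ℕ) + z.2)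
    rw [this]
  rw [e, div_le_one (by positivity)]
  calc (z.1 : ℝ) ^ i * (z.2 : ℝ) ^ (K - i)
      ≤ ((z.1 : ℝ) + z.2) ^ i * ((z.1 : ℝ) + z.2) ^ (K - i) := by
        gcongr <;> linarith
    _ = _ := by rw [← pow_add, Nat.add_sub_cancel' hi]

theorem summable_splitTerm {K i : ℕ} (hi : i ≤ K) {s : ℂ} (hs : 2 / 3 < s.re) :
    Summable (splitTerm K i s) :=
  Summable.of_norm_bounded ((summable_omegaTerm_iff s).2 hs).norm (norm_splitTerm_le hi s)

/-- The real exponents i, K - i, -K add up to 0, as `tsum_pow_mul_powKernel` demands. -/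
theorem splitTerm_eq_powKernel {K i : ℕ} (hi : i ≤ K) (s : ℂ) (z : ℕ+ × ℕ+) :
    splitTerm K i s z = (z.1 : ℂ) ^ ((i : ℝ) - s) *
      powKernel (((K : ℝ) - i : ℝ) - s) ((-(K : ℝ) : ℝ) - s) z.1 z.2 := by
  have hj : (z.1 : ℂ) ≠ 0 := by exact_mod_cast z.1.ne_zero
  have hk : (z.2 : ℂ) ≠ 0 := by exact_mod_cast z.2.ne_zero
  have hjk := pnat_add_ne_zero z
  have e1 : omegaTerm s z = (z.1 : ℂ) ^ (-s) * (z.2 : ℂ) ^ (-s) * ((z.1 : ℂ) + z.2) ^ (-s) := by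
    rw [omegaTerm_eq]
    rw [PNat.mul_coe, PNat.mul_coe, PNat.add_coe, Nat.cast_mul,
      Complex.natCast_mul_natCast_cpow, Nat.cast_mul, Complex.natCast_mul_natCast_cpow,
      Nat.cast_add]
  rw [splitTerm, e1, powKernel]
  have e2 : ((K : ℝ) - i : ℝ) = ((K - i : ℕ) : ℝ) := by rw [Nat.cast_sub hi]
  rw [e2]
  push_cast
  rw [sub_eq_add_neg (i : ℂ), sub_eq_add_neg (-(K : ℂ)), sub_eq_add_neg _ s,
    Complex.cpow_add _ _ hj,
    Complex.cpow_add _ _ hk, Complex.cpow_add _ _ hjk, Complex.cpow_neg _ (K : ℂ)]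
  simp only [Complex.cpow_natCast]
  field_simp

/-- Half of the binomial splitting suffices, by symmetry. -/
theorem omegaSeries_eq_two_mul_sum (r : ℕ) {s : ℂ} (hs : 2 / 3 < s.re) :
    omegaSeries s = 2 * ∑ i ∈ Finset.range (r + 1),
      ((2 * r + 1).choose i : ℂ) * ∑' z, splitTerm (2 * r + 1) i s z := by
  have h1 : omegaSeries s = ∑ i ∈ Finset.range ((r + 1) + (r + 1)),
      ((2 * r + 1).choose i : ℂ) * ∑' z, splitTerm (2 * r + 1) i s z := by
    have hsum : ∀ i ∈ Finset.range ((r + 1) + (r + 1)),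
        Summable fun z => ((2 * r + 1).choose i : ℂ) * splitTerm (2 * r + 1) i s z := fun i hi =>
      (summable_splitTerm (by have := Finset.mem_range.1 hi; omega) hs).mul_left _
    simp only [← tsum_mul_left]
    rw [← Summable.tsum_finsetSum hsum, omegaSeries]
    refine tsum_congr fun z => ?_
    rw [← sum_choose_mul_splitTerm (2 * r + 1) s z]
    congr 2
    ring
  rw [h1, Finset.sum_range_add]
  refine Eq.trans ?_ (two_mul _).symm
  congr 1
  -- Since 2r + 1 is odd, i ↦ 2r + 1 - i exchanges the two halves and leaves no middle term.
  rw [← Finset.sum_range_reflect (fun i => ((2 * r + 1).choose (r + 1 + i) : ℂ) *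
    ∑' z, splitTerm (2 * r + 1) (r + 1 + i) s z)]
  refine Finset.sum_congr rfl fun i hi => ?_
  have hi' : i ≤ r := Nat.lt_succ_iff.1 (Finset.mem_range.1 hi)
  have e : r + 1 + (r + 1 - 1 - i) = 2 * r + 1 - i := by omega
  rw [e, Nat.choose_symm (by omega)]
  congr 1
  rw [← (Equiv.prodComm ℕ+ ℕ+).tsum_eq (splitTerm (2 * r + 1) i s)]
  exact tsum_congr fun z => splitTerm_swap (by omega) s z

/-- Multiply the Beta integrand by (x + (1-x))^K = 1 and expand. -/
theorem sum_choose_mul_betaIntegral (K : ℕ) {u v : ℂ} (hu : 0 < u.re) (hv : 0 < v.re) :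
    ∑ i ∈ Finset.range (K + 1), (K.choose i : ℂ) *
      Complex.betaIntegral (u + i) (v + (K - i : ℕ)) = Complex.betaIntegral u v := by
  have hint : ∀ i ∈ Finset.range (K + 1), IntervalIntegrable (fun x : ℝ => (K.choose i : ℂ) *
      ((x : ℂ) ^ (u + i - 1) * (1 - (x : ℂ)) ^ (v + (K - i : ℕ) - 1))) volume 0 1 := fun i _ =>
    (Complex.betaIntegral_convergent (u := u + i) (v := v + (K - i : ℕ))
      (by simp; positivity) (by
        rw [Complex.add_re, Complex.natCast_re]
        positivity)).const_mul _
  simp only [Complex.betaIntegral, ← intervalIntegral.integral_const_mul]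
  rw [← intervalIntegral.integral_finsetSum hint, intervalIntegral.integral_of_le zero_le_one,
    intervalIntegral.integral_of_le zero_le_one, ← setIntegral_congr_set Ioo_ae_eq_Ioc,
    ← setIntegral_congr_set Ioo_ae_eq_Ioc]
  refine setIntegral_congr_fun measurableSet_Ioo fun x hx => ?_
  have hx0 : (x : ℂ) ≠ 0 := by exact_mod_cast hx.1.ne'
  have hx1 : (1 - (x : ℂ)) ≠ 0 := by
    rw [← Complex.ofReal_one, ← Complex.ofReal_sub]
    exact_mod_cast (sub_pos.2 hx.2).ne'
  have h := add_pow (x : ℂ) (1 - x) K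
  rw [add_sub_cancel, one_pow] at h
  refine Eq.trans ?_ (mul_one ((x : ℂ) ^ (u - 1) * (1 - (x : ℂ)) ^ (v - 1)))
  refine Eq.trans ?_ (congrArg (fun w => (x : ℂ) ^ (u - 1) * (1 - (x : ℂ)) ^ (v - 1) * w) h.symm)
  rw [Finset.mul_sum]
  refine Finset.sum_congr rfl fun i _ => ?_
  rw [show u + (i : ℂ) - 1 = u - 1 + i by ring,
    show v + ((K - i : ℕ) : ℂ) - 1 = v - 1 + (K - i : ℕ) by ring, Complex.cpow_add _ _ hx0,
    Complex.cpow_add _ _ hx1, Complex.cpow_natCast, Complex.cpow_natCast]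
  ring

/-- The upper half of the binomial expansion of `B(2s - 1, 1 - s)`. -/
noncomputable def betaTail (r : ℕ) (s : ℂ) : ℂ :=
  ∑ i ∈ Finset.range (r + 1), ((2 * r + 1).choose (r + 1 + i) : ℂ) *
    Complex.betaIntegral (2 * s - 1 + (r + 1 + i : ℕ)) (1 - s + (r - i : ℕ))

/-- The duplication formula at s - 1/2 replaces Γ(2s-1)/Γ(s) by a multiple of Γ(s-1/2). -/
theorem two_mul_betaIntegral_eq {s : ℂ} (h1 : 1 / 2 < s.re) (h2 : s.re < 1) :
    2 * Complex.betaIntegral (2 * s - 1) (1 - s) =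
      2 ^ (2 * s - 1) * Complex.Gamma (s - 1 / 2) * Complex.Gamma (1 - s) / √Real.pi := by
  rw [Complex.betaIntegral_eq_Gamma_mul_div _ _ (by simp; linarith) (by simp; linarith)]
  have h := Complex.Gamma_mul_Gamma_add_half (s - 1 / 2)
  have e1 : s - 1 / 2 + 1 / 2 = s := by ring
  have e2 : 2 * (s - 1 / 2) = 2 * s - 1 := by ring
  rw [e1, e2] at h
  have hG : Complex.Gamma s ≠ 0 := Complex.Gamma_ne_zero_of_re_pos (by linarith)
  have hpi : ((√Real.pi : ℝ) : ℂ) ≠ 0 := by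
    exact_mod_cast (Real.sqrt_pos.2 Real.pi_pos).ne'
  have e4 : 2 * s - 1 + (1 - s) = s := by ring
  have h2pow : (2 : ℂ) ^ (2 * s - 1) * 2 ^ (1 - (2 * s - 1)) = 2 := by
    rw [← Complex.cpow_add _ _ two_ne_zero]
    simp
  rw [e4, ← mul_div_assoc, div_eq_div_iff hG hpi]
  linear_combination (-1) * 2 ^ (2 * s - 1) * Complex.Gamma (1 - s) * h -
    Complex.Gamma (2 * s - 1) * Complex.Gamma (1 - s) * √Real.pi * h2pow

/-- The lower half is traded for the full Beta value minus the upper half. The upper half stays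
holomorphic far to the left, so every pole of this factor is visible in the Gamma product. -/
theorem two_mul_sum_betaIntegral_eq (r : ℕ) {s : ℂ} (h1 : 1 / 2 < s.re) (h2 : s.re < 1) :
    2 * ∑ i ∈ Finset.range (r + 1), ((2 * r + 1).choose i : ℂ) *
        Complex.betaIntegral (2 * s - 1 + i) (1 - s + (2 * r + 1 - i : ℕ)) =
      2 ^ (2 * s - 1) * Complex.Gamma (s - 1 / 2) * Complex.Gamma (1 - s) / √Real.pi -
        2 * betaTail r s := by
  have h := sum_choose_mul_betaIntegral (2 * r + 1) (u := 2 * s - 1) (v := 1 - s)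
    (by simp; linarith) (by simp; linarith)
  rw [show 2 * r + 1 + 1 = (r + 1) + (r + 1) by ring, Finset.sum_range_add] at h
  rw [← two_mul_betaIntegral_eq h1 h2, ← h, betaTail]
  have e : ∀ i : ℕ, 2 * r + 1 - (r + 1 + i) = r - i := fun i => by omega
  simp only [e]
  ring

/-- For i ≤ r the exponent K - i of k is at least r + 1, just enough for one Euler–Maclaurin step
and r integrations by parts up to Re s = 1. The j-th remainder is then of order j^(-r - 3 Re s),
summable for Re s > (1-r)/3. -/
theorem exists_omegaRemainder (r : ℕ) : ∃ H : ℂ → ℂ,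
    DifferentiableOn ℂ H (Complex.re ⁻¹' Ioo ((1 - r) / 3) 1) ∧
    (∀ α β : ℝ, (1 - r) / 3 < α → β < 1 → PolyGrowth H (Complex.re ⁻¹' Icc α β)) ∧
    ∀ s : ℂ, 2 / 3 < s.re → s.re < 1 →
      omegaSeries s = riemannZeta (3 * s - 1) *
        (2 ^ (2 * s - 1) * Complex.Gamma (s - 1 / 2) * Complex.Gamma (1 - s) / √Real.pi -
          2 * betaTail r s) + H s := by
  have key : ∀ i : ℕ, i ≤ r → ∃ H : ℂ → ℂ,
      DifferentiableOn ℂ H (Complex.re ⁻¹' Ioo ((1 - r) / 3) 1) ∧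
      (∀ α β : ℝ, (1 - r) / 3 < α → β < 1 → PolyGrowth H (Complex.re ⁻¹' Icc α β)) ∧
      ∀ s : ℂ, 2 / 3 < s.re → s.re < 1 →
        ∑' z, splitTerm (2 * r + 1) i s z = riemannZeta (3 * s - 1) *
          Complex.betaIntegral (2 * s - 1 + i) (1 - s + (2 * r + 1 - i : ℕ)) + H s := by
    intro i hi
    have hi' : (i : ℝ) ≤ r := by exact_mod_cast hi
    have hi0 : (0 : ℝ) ≤ i := by positivity
    set K : ℕ := 2 * r + 1 with hK
    have hKr : (K : ℝ) = 2 * r + 1 := by rw [hK]; push_cast; ring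
    have hiK : i ≤ K := by omega
    obtain ⟨E₁, hd₁, hg₁, he₁⟩ :=
      exists_continuation_bernoulliSeries i r 1 one_ne_zero ((K : ℝ) - i - 1) (-K)
    obtain ⟨E₂, hd₂, hg₂, he₂⟩ :=
      exists_continuation_bernoulliSeries i r 1 one_ne_zero ((K : ℝ) - i) (-K - 1)
    refine ⟨fun s => (((K : ℝ) - i : ℝ) - s) * E₁ s + ((-(K : ℝ) : ℝ) - s) * E₂ s, ?_,
      fun α β h1 h2 => ?_, fun s h1 h2 => ?_⟩
    · have d₁ := hd₁ ((1 - r) / 3) 1 (by linarith) (by linarith) (by linarith)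
      have d₂ := hd₂ ((1 - r) / 3) 1 (by linarith) (by linarith) (by linarith)
      fun_prop
    · have g₁ := hg₁ α β (by linarith) (by linarith) (by linarith)
      have g₂ := hg₂ α β (by linarith) (by linarith) (by linarith)
      have hid := PolyGrowth.id_strip α β
      exact (((PolyGrowth.const _).sub hid).mul g₁).add (((PolyGrowth.const _).sub hid).mul g₂)
    · have hsum := summable_splitTerm (s := s) hiK h1
      rw [funext (splitTerm_eq_powKernel hiK s)] at hsum ⊢
      have h := tsum_pow_mul_powKernel (a := i) (p := (K : ℝ) - i) (q := -(K : ℝ)) (s := s)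
        (by ring) (by linarith) (by linarith) h1 hsum
      dsimp only
      rw [h, he₁ s (by linarith) (by linarith) (by linarith),
        he₂ s (by linarith) (by linarith) (by linarith), Complex.betaIntegral_symm]
      have e1 : 2 * s - (((K : ℝ) - i : ℝ) : ℂ) - ((-(K : ℝ) : ℝ) : ℂ) - 1 = 2 * s - 1 + i := by
        push_cast
        ring
      have e2 : (((K : ℝ) - i : ℝ) : ℂ) - s + 1 = 1 - s + (K - i : ℕ) := by
        rw [Nat.cast_sub hiK]
        push_cast
        ring
      rw [e1, e2]
  choose! H hHd hHg hHe using key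
  refine ⟨fun s => 2 * ∑ i ∈ Finset.range (r + 1), ((2 * r + 1).choose i : ℂ) * H i s, ?_,
    fun α β h1 h2 => ?_, fun s h1 h2 => ?_⟩
  · refine DifferentiableOn.const_mul (DifferentiableOn.fun_sum fun i hi => ?_) _
    exact (hHd i (Nat.lt_succ_iff.1 (Finset.mem_range.1 hi))).const_mul _
  · refine (PolyGrowth.const _).mul (PolyGrowth.sum _ fun i hi => (PolyGrowth.const _).mul ?_)
    exact hHg i (Nat.lt_succ_iff.1 (Finset.mem_range.1 hi)) α β h1 h2
  · rw [← two_mul_sum_betaIntegral_eq r (by linarith) h2, omegaSeries_eq_two_mul_sum r h1,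
      mul_left_comm, ← mul_add]
    congr 1
    rw [Finset.mul_sum, ← Finset.sum_add_distrib]
    refine Finset.sum_congr rfl fun i hi => ?_
    rw [hHe i (Nat.lt_succ_iff.1 (Finset.mem_range.1 hi)) s h1 h2]
    ring

/-! ### Simple poles; analyticity and growth of the Gamma and Beta factors -/

theorem hasSimplePoleWithResidue_of_div {f W : ℂ → ℂ} {z₀ r : ℂ} (hf : AnalyticAt ℂ f z₀)
    (hr : f z₀ = r) (hr0 : r ≠ 0) (h : ∀ᶠ z in 𝓝[≠] z₀, W z = f z / (z - z₀)) :
    HasSimplePoleWithResidue W z₀ r := by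
  -- The regular part of f(z)/(z - z₀) is the divided difference of f at z₀.
  refine ⟨hr0, dslope f z₀, ?_, ?_⟩
  · obtain ⟨p, hp⟩ := hf
    exact ⟨_, hp.has_fpower_series_dslope_fslope⟩
  · filter_upwards [h, self_mem_nhdsWithin] with z hz hne
    have hne' : z - z₀ ≠ 0 := sub_ne_zero.2 hne
    rw [hz, dslope_of_ne _ hne, slope_def_field, hr]
    field_simp
    ring

theorem HasSimplePoleWithResidue.meromorphicAt {W : ℂ → ℂ} {z₀ r : ℂ}
    (h : HasSimplePoleWithResidue W z₀ r) : MeromorphicAt W z₀ := by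
  obtain ⟨-, g, hg, he⟩ := h
  have h1 : MeromorphicAt (fun z => r / (z - z₀) + g z) z₀ :=
    ((MeromorphicAt.const r z₀).div ((MeromorphicAt.id z₀).sub (.const z₀ z₀))).add
      hg.meromorphicAt
  exact h1.congr (he.mono fun z hz => hz.symm)

/-- The meromorphic factor `2 ^ (2 s - 1) Γ(s - 1/2) Γ(1 - s) / √π`. -/
noncomputable def gammaFactor (s : ℂ) : ℂ :=
  2 ^ (2 * s - 1) * Complex.Gamma (s - 1 / 2) * Complex.Gamma (1 - s) / √Real.pi

theorem sqrt_pi_ne_zero : ((√Real.pi : ℝ) : ℂ) ≠ 0 := by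
  exact_mod_cast (Real.sqrt_pos.2 Real.pi_pos).ne'

theorem analyticAt_Gamma_of_ne_neg_nat {s : ℂ} (hs : ∀ m : ℕ, s ≠ -m) :
    AnalyticAt ℂ Complex.Gamma s := by
  have h1 : AnalyticAt ℂ (fun s => (Complex.Gamma s)⁻¹) s :=
    Complex.differentiable_one_div_Gamma.analyticAt s
  have h2 := h1.inv (inv_ne_zero (Complex.Gamma_ne_zero hs))
  have e : (fun s => (Complex.Gamma s)⁻¹)⁻¹ = Complex.Gamma := by
    funext w
    simp
  rwa [e] at h2

theorem analyticAt_Gamma_of_re_pos {s : ℂ} (hs : 0 < s.re) : AnalyticAt ℂ Complex.Gamma s :=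
  analyticAt_Gamma_of_ne_neg_nat fun m h => by
    rw [h] at hs
    simp at hs
    linarith [(Nat.cast_nonneg m : (0 : ℝ) ≤ m)]

theorem analyticAt_two_cpow (s : ℂ) : AnalyticAt ℂ (fun s : ℂ => (2 : ℂ) ^ (2 * s - 1)) s := by
  have : Differentiable ℂ fun s : ℂ => (2 : ℂ) ^ (2 * s - 1) :=
    ((differentiable_id.const_mul 2).sub_const 1).const_cpow (Or.inl two_ne_zero)
  exact this.analyticAt s

theorem analyticAt_Gamma_one_sub {s : ℂ} (hs : s.re < 1) :
    AnalyticAt ℂ (fun s => Complex.Gamma (1 - s)) s := by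
  have h : AnalyticAt ℂ Complex.Gamma (1 - s) :=
    analyticAt_Gamma_of_re_pos (by simpa using hs)
  exact h.fun_comp (f := fun s => 1 - s) (by fun_prop)

theorem analyticAt_gammaFactor {s : ℂ} (hs : s.re < 1) (hs' : ∀ k : ℕ, s ≠ 1 / 2 - k) :
    AnalyticAt ℂ gammaFactor s := by
  have h1 : AnalyticAt ℂ Complex.Gamma (s - 1 / 2) :=
    analyticAt_Gamma_of_ne_neg_nat fun m h => hs' m (by linear_combination h)
  have h2 : AnalyticAt ℂ (fun s => Complex.Gamma (s - 1 / 2)) s :=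
    h1.fun_comp (f := fun s => s - 1 / 2) (by fun_prop)
  exact (((analyticAt_two_cpow s).mul h2).mul (analyticAt_Gamma_one_sub hs)).div analyticAt_const
    sqrt_pi_ne_zero

theorem prod_mul_Gamma (n : ℕ) {w : ℂ} (h : ∀ i < n, w + i ≠ 0) :
    (∏ i ∈ Finset.range n, (w + i)) * Complex.Gamma w = Complex.Gamma (w + n) := by
  induction n with
  | zero => simp
  | succ n ih =>
    rw [Finset.prod_range_succ, mul_right_comm, ih fun i hi => h i (by omega)]
    push_cast
    rw [← add_assoc, Complex.Gamma_add_one _ (h n (by omega)), mul_comm]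

/-- Stirling's formula is not needed: Γ(s-1/2+n) Γ(1-s) = Γ(n+1/2) B(s-1/2+n, 1-s) has a constant
argument sum, and the Beta value is bounded on the strip once n > 1/2 - a. Returning to Γ(s-1/2)
costs division by factors of modulus at least |Im s| ≥ 1. -/
theorem polyGrowth_gammaFactor (a : ℝ) {b : ℝ} (hb : b < 1) :
    PolyGrowth gammaFactor (Complex.re ⁻¹' Icc a b) := by
  obtain ⟨n, hn⟩ := exists_nat_gt (1 / 2 - a)
  obtain ⟨B, hB0, hB⟩ := exists_norm_betaIntegral_le (a := a) (b := b) (m := 1) (c := n - 1 / 2)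
    (m' := -1) (c' := 1) fun σ hσ => ⟨by linarith [hσ.1], by linarith [hσ.2]⟩
  have h1 : PolyGrowth (fun s => (2 : ℂ) ^ (2 * s - 1)) (Complex.re ⁻¹' Icc a b) := by
    refine PolyGrowth.of_bounded (C := (2 : ℝ) ^ (2 * b - 1)) fun s hs _ => ?_
    have := Complex.norm_cpow_eq_rpow_re_of_pos (x := 2) two_pos (2 * s - 1)
    push_cast at this
    rw [this]
    refine Real.rpow_le_rpow_of_exponent_le one_le_two ?_
    simp
    linarith [hs.2]
  have h2 : PolyGrowth (fun s => Complex.betaIntegral (s - 1 / 2 + n) (1 - s))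
      (Complex.re ⁻¹' Icc a b) :=
    PolyGrowth.of_bounded fun s hs _ => hB s.re hs _ _ (by simp; ring) (by simp; ring)
  have him : ∀ (i : ℕ) (s : ℂ), |s.im| ≤ ‖s - 1 / 2 + i‖ := fun i s => by
    have := Complex.abs_im_le_norm (s - 1 / 2 + i)
    simpa using this
  have h3 : PolyGrowth (fun s => ∏ i ∈ Finset.range n, (s - 1 / 2 + i)⁻¹)
      (Complex.re ⁻¹' Icc a b) :=
    PolyGrowth.prod _ fun i _ => PolyGrowth.inv_of_im fun s _ => him i s
  refine ((((h1.mul h2).mul h3).mul (.const (Complex.Gamma (1 / 2 + n)))).mul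
    (.const (((√Real.pi : ℝ) : ℂ)⁻¹))).congr fun s hs ht => ?_
  have hne : ∀ i : ℕ, s - 1 / 2 + i ≠ 0 := fun i h => by
    have := him i s
    rw [h, norm_zero] at this
    linarith
  have hG := prod_mul_Gamma n (w := s - 1 / 2) fun i _ => hne i
  have hBeta := Complex.Gamma_mul_Gamma_eq_betaIntegral (s := s - 1 / 2 + n) (t := 1 - s)
    (by simp; linarith [hs.1]) (by simp; linarith [hs.2])
  rw [show s - 1 / 2 + n + (1 - s) = 1 / 2 + n by ring, ← hG] at hBeta
  have hprod : ∏ i ∈ Finset.range n, (s - 1 / 2 + i) ≠ 0 :=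
    Finset.prod_ne_zero_iff.2 fun i _ => hne i
  rw [gammaFactor, Finset.prod_inv_distrib, div_eq_mul_inv]
  congr 1
  set P := ∏ i ∈ Finset.range n, (s - 1 / 2 + i) with hP
  have hPinv : P * P⁻¹ = 1 := mul_inv_cancel₀ hprod
  linear_combination 2 ^ (2 * s - 1) * P⁻¹ * hBeta -
    2 ^ (2 * s - 1) * Complex.Gamma (s - 1 / 2) * Complex.Gamma (1 - s) * hPinv

theorem betaTail_pos (r i : ℕ) {σ : ℝ} (h1 : (1 - r) / 3 < σ) (h2 : σ < 1) :
    0 < 2 * σ - 1 + (r + 1 + i : ℕ) ∧ 0 < -σ + (1 + (r - i : ℕ)) := by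
  have hi0 : (0 : ℝ) ≤ i := by positivity
  have hr0 : (0 : ℝ) ≤ r := by positivity
  have hri : (0 : ℝ) ≤ (r - i : ℕ) := by positivity
  push_cast
  constructor <;> linarith

theorem analyticAt_betaIntegral {u v : ℂ → ℂ} {s : ℂ} (hu : AnalyticAt ℂ u s)
    (hv : AnalyticAt ℂ v s) (hu0 : 0 < (u s).re) (hv0 : 0 < (v s).re) :
    AnalyticAt ℂ (fun s => Complex.betaIntegral (u s) (v s)) s := by
  have h1 : AnalyticAt ℂ (fun s => Complex.Gamma (u s)) s :=
    (analyticAt_Gamma_of_re_pos hu0).fun_comp hu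
  have h2 : AnalyticAt ℂ (fun s => Complex.Gamma (v s)) s :=
    (analyticAt_Gamma_of_re_pos hv0).fun_comp hv
  have h3 : AnalyticAt ℂ (fun s => (Complex.Gamma (u s + v s))⁻¹) s :=
    (Complex.differentiable_one_div_Gamma.analyticAt (u s + v s)).fun_comp (f := fun s => u s + v s)
      (hu.add hv)
  refine ((h1.mul h2).mul h3).congr ?_
  have c1 : ∀ᶠ w in 𝓝 s, 0 < (u w).re :=
    (Complex.continuous_re.continuousAt.comp hu.continuousAt).eventually (lt_mem_nhds hu0)
  have c2 : ∀ᶠ w in 𝓝 s, 0 < (v w).re :=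
    (Complex.continuous_re.continuousAt.comp hv.continuousAt).eventually (lt_mem_nhds hv0)
  filter_upwards [c1, c2] with w hw1 hw2
  rw [Complex.betaIntegral_eq_Gamma_mul_div _ _ hw1 hw2, div_eq_mul_inv]
  rfl

theorem analyticAt_betaTail {r : ℕ} {s : ℂ} (hs : s.re ∈ Ioo ((1 - r : ℝ) / 3) 1) :
    AnalyticAt ℂ (betaTail r) s := by
  refine Finset.analyticAt_fun_sum _ fun i _ => analyticAt_const.mul ?_
  obtain ⟨h1, h2⟩ := betaTail_pos r i hs.1 hs.2
  refine analyticAt_betaIntegral (by fun_prop) (by fun_prop) ?_ ?_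
  · simpa using h1
  · rw [Complex.add_re, Complex.natCast_re]
    simp only [Complex.sub_re, Complex.one_re]
    linarith

theorem polyGrowth_betaTail {r : ℕ} {a b : ℝ} (ha : (1 - r : ℝ) / 3 < a) (hb : b < 1) :
    PolyGrowth (betaTail r) (Complex.re ⁻¹' Icc a b) := by
  refine PolyGrowth.sum _ fun i _ => (PolyGrowth.const _).mul ?_
  obtain ⟨B, hB0, hB⟩ := exists_norm_betaIntegral_le (a := a) (b := b) (m := 2)
    (c := -1 + (r + 1 + i : ℕ)) (m' := -1) (c' := 1 + (r - i : ℕ)) fun σ hσ => by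
      obtain ⟨h1, h2⟩ := betaTail_pos r i
        (ha.trans_le hσ.1) (hσ.2.trans_lt hb)
      exact ⟨by linarith, by linarith⟩
  refine PolyGrowth.of_bounded fun s hs _ => hB s.re hs _ _ ?_ ?_
  · rw [Complex.add_re, Complex.natCast_re]
    simp
    ring
  · rw [Complex.add_re, Complex.natCast_re]
    simp
    ring

/-! ### Gluing the strips into one continuation -/

/-- The holomorphic remainder in the continuation of `ω` to `Re s > (1 - r) / 3`. -/
noncomputable def omegaRemainder (r : ℕ) : ℂ → ℂ := (exists_omegaRemainder r).choose

theorem analyticAt_omegaRemainder {r : ℕ} {s : ℂ} (hs : s.re ∈ Ioo ((1 - r : ℝ) / 3) 1) :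
    AnalyticAt ℂ (omegaRemainder r) s :=
  (exists_omegaRemainder r).choose_spec.1.analyticAt ((isOpen_re_preimage_Ioo _ _).mem_nhds hs)

theorem polyGrowth_omegaRemainder {r : ℕ} {a b : ℝ} (ha : (1 - r : ℝ) / 3 < a) (hb : b < 1) :
    PolyGrowth (omegaRemainder r) (Complex.re ⁻¹' Icc a b) :=
  (exists_omegaRemainder r).choose_spec.2.1 a b ha hb

/-- The continuation of `ω` to the strip `(1 - r) / 3 < Re s < 1`. -/
noncomputable def omegaStrip (r : ℕ) (s : ℂ) : ℂ :=
  riemannZeta (3 * s - 1) * (gammaFactor s - 2 * betaTail r s) + omegaRemainder r s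

theorem omegaSeries_eq_omegaStrip (r : ℕ) {s : ℂ} (h1 : 2 / 3 < s.re) (h2 : s.re < 1) :
    omegaSeries s = omegaStrip r s :=
  (exists_omegaRemainder r).choose_spec.2.2 s h1 h2

theorem three_mul_sub_one_ne_one {s : ℂ} (hs : s ≠ 2 / 3) : 3 * s - 1 ≠ 1 := fun h =>
  hs (by linear_combination h / 3)

theorem riemannZeta_three_mul_sub_one {s : ℂ} (hs : s ≠ 2 / 3) :
    (3 * s - 2) * riemannZeta (3 * s - 1) = riemannZeta₁ (3 * s - 1) := by
  rw [riemannZeta₁_eq (three_mul_sub_one_ne_one hs)]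
  ring

/-- In the difference `gammaFactor` cancels, and the factor 3s - 2 clears the pole of ζ(3s-1). What
is left is holomorphic on the common strip and zero for 2/3 < Re s < 1. -/
theorem omegaStrip_eq_omegaStrip {r r' : ℕ} {s : ℂ} (h : s.re ∈ Ioo ((1 - r : ℝ) / 3) 1)
    (h' : s.re ∈ Ioo ((1 - r' : ℝ) / 3) 1) (hs : s ≠ 2 / 3) :
    omegaStrip r s = omegaStrip r' s := by
  set c : ℝ := max ((1 - r : ℝ) / 3) ((1 - r' : ℝ) / 3) with hc
  have hc1 : c ≤ 1 / 3 := by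
    have h1 : (0 : ℝ) ≤ r := by positivity
    have h2 : (0 : ℝ) ≤ r' := by positivity
    exact max_le (by linarith) (by linarith)
  set D : ℂ → ℂ := fun s => riemannZeta₁ (3 * s - 1) * (2 * betaTail r' s - 2 * betaTail r s) +
    (3 * s - 2) * (omegaRemainder r s - omegaRemainder r' s) with hD
  have hDeq : ∀ w : ℂ, w ≠ 2 / 3 → D w = (3 * w - 2) * (omegaStrip r w - omegaStrip r' w) := by
    intro w hw
    rw [hD, omegaStrip, omegaStrip]
    beta_reduce
    rw [← riemannZeta_three_mul_sub_one hw]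
    ring
  have hDa : AnalyticOnNhd ℂ D (Complex.re ⁻¹' Ioo c 1) := by
    intro w hw
    have hr : w.re ∈ Ioo ((1 - r : ℝ) / 3) 1 := ⟨(le_max_left _ _).trans_lt hw.1, hw.2⟩
    have hr' : w.re ∈ Ioo ((1 - r' : ℝ) / 3) 1 := ⟨(le_max_right _ _).trans_lt hw.1, hw.2⟩
    have hz : AnalyticAt ℂ (fun s : ℂ => riemannZeta₁ (3 * s - 1)) w :=
      (differentiable_riemannZeta₁.analyticAt _).fun_comp (f := fun s => 3 * s - 1) (by fun_prop)
    exact (hz.mul ((analyticAt_const.mul (analyticAt_betaTail hr')).sub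
      (analyticAt_const.mul (analyticAt_betaTail hr)))).add
      (((analyticAt_const.mul analyticAt_id).sub analyticAt_const).mul
        ((analyticAt_omegaRemainder hr).sub (analyticAt_omegaRemainder hr')))
  have hpre : IsPreconnected (Complex.re ⁻¹' Ioo c 1) :=
    ((convex_Ioo c 1).is_linear_preimage Complex.reLm.isLinear).isPreconnected
  have h56 : ((5 / 6 : ℝ) : ℂ) ∈ Complex.re ⁻¹' Ioo c 1 := by
    simp only [mem_preimage, Complex.ofReal_re]
    constructor <;> linarith
  have hzero := hDa.eqOn_zero_of_preconnected_of_eventuallyEq_zero hpre h56 (by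
    have hmem : ((5 / 6 : ℝ) : ℂ) ∈ Complex.re ⁻¹' Ioo (2 / 3) 1 := by
      simp only [mem_preimage, Complex.ofReal_re]
      norm_num
    filter_upwards [(isOpen_re_preimage_Ioo (2 / 3) 1).mem_nhds hmem] with w hw
    have hw23 : w ≠ 2 / 3 := by
      rintro rfl
      have := hw.1
      norm_num at this
    rw [hDeq w hw23, ← omegaSeries_eq_omegaStrip r hw.1 hw.2,
      ← omegaSeries_eq_omegaStrip r' hw.1 hw.2]
    simp)
  have h0 : D s = 0 := hzero (show s.re ∈ Ioo c 1 from ⟨max_lt h.1 h'.1, h.2⟩)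
  rw [hDeq s hs] at h0
  refine sub_eq_zero.1 ((mul_eq_zero.1 h0).resolve_left fun h3 => hs ?_)
  linear_combination h3 / 3

/-- The meromorphic continuation of `ω`. -/
noncomputable def omegaContinuation (s : ℂ) : ℂ :=
  open Classical in
  -- This index r satisfies r > 1 - 3 Re s, so s lies in its strip.
  if 2 / 3 < s.re then omegaSeries s else omegaStrip (⌊1 - 3 * s.re⌋₊ + 1) s

theorem omegaContinuation_of_lt {s : ℂ} (hs : 2 / 3 < s.re) :
    omegaContinuation s = omegaSeries s := if_pos hs

theorem omegaContinuation_eq_omegaStrip {r : ℕ} {s : ℂ} (h : s.re ∈ Ioo ((1 - r : ℝ) / 3) 1)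
    (hs : s ≠ 2 / 3) : omegaContinuation s = omegaStrip r s := by
  by_cases h1 : 2 / 3 < s.re
  · rw [omegaContinuation_of_lt h1, omegaSeries_eq_omegaStrip r h1 h.2]
  · rw [omegaContinuation, if_neg h1]
    refine omegaStrip_eq_omegaStrip ⟨?_, h.2⟩ h hs
    have := Nat.lt_floor_add_one (1 - 3 * s.re)
    push_cast
    linarith

theorem eventually_omegaContinuation_eq {r : ℕ} {s : ℂ} (h : s.re ∈ Ioo ((1 - r : ℝ) / 3) 1) :
    ∀ᶠ w in 𝓝[≠] s, w ≠ 2 / 3 ∧ omegaContinuation w = omegaStrip r w := by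
  have h23 : ∀ᶠ w in 𝓝[≠] s, w ≠ 2 / 3 := by
    by_cases hs : s = 2 / 3
    · rw [hs]
      exact self_mem_nhdsWithin
    · exact nhdsWithin_le_nhds (isOpen_ne.mem_nhds hs)
  filter_upwards [h23, nhdsWithin_le_nhds ((isOpen_re_preimage_Ioo _ _).mem_nhds h)] with w hw hw'
  exact ⟨hw, omegaContinuation_eq_omegaStrip hw' hw⟩

theorem exists_strip_index (c : ℝ) : ∃ r : ℕ, (1 - r : ℝ) / 3 < c := by
  obtain ⟨r, hr⟩ := exists_nat_gt (1 - 3 * c)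
  exact ⟨r, by linarith⟩

theorem analyticAt_riemannZeta_three_mul_sub_one {s : ℂ} (hs : s ≠ 2 / 3) :
    AnalyticAt ℂ (fun s => riemannZeta (3 * s - 1)) s := by
  have h : AnalyticAt ℂ riemannZeta (3 * s - 1) :=
    analyticOn_riemannZeta _ (three_mul_sub_one_ne_one hs)
  exact h.fun_comp (f := fun s => 3 * s - 1) (by fun_prop)

theorem analyticAt_omegaContinuation {s : ℂ} (hs : s ≠ 2 / 3) (hs' : ∀ k : ℕ, s ≠ 1 / 2 - k) :
    AnalyticAt ℂ omegaContinuation s := by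
  by_cases h1 : 2 / 3 < s.re
  · have hopen : IsOpen {s : ℂ | 2 / 3 < s.re} := isOpen_lt continuous_const Complex.continuous_re
    refine (differentiableOn_omegaSeries.analyticAt (hopen.mem_nhds h1)).congr ?_
    filter_upwards [hopen.mem_nhds h1] with w hw
    exact (omegaContinuation_of_lt hw).symm
  · have h2 : s.re < 1 := by linarith
    obtain ⟨r, hr⟩ := exists_strip_index s.re
    have hmem : s.re ∈ Ioo ((1 - r : ℝ) / 3) 1 := ⟨hr, h2⟩
    have hA : AnalyticAt ℂ (omegaStrip r) s :=
      ((analyticAt_riemannZeta_three_mul_sub_one hs).mul ((analyticAt_gammaFactor h2 hs').sub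
        (analyticAt_const.mul (analyticAt_betaTail hmem)))).add (analyticAt_omegaRemainder hmem)
    refine hA.congr ?_
    filter_upwards [(isOpen_re_preimage_Ioo _ _).mem_nhds hmem, isOpen_ne.mem_nhds hs] with w hw hw'
    exact (omegaContinuation_eq_omegaStrip hw hw').symm

/-! ### Residues and their nonvanishing -/

theorem gammaFactor_sub_betaTail_two_thirds :
    gammaFactor (2 / 3) - 2 * betaTail 0 (2 / 3) =
      ((Real.Gamma (1 / 3) ^ 3 * √3 / (2 * Real.pi) : ℝ) : ℂ) := by
  -- For r = 0 the left side is 2B(1/3, 4/3), which by symmetry is the full two-term splitting of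
  -- B(1/3, 1/3) = Γ(1/3)²/Γ(2/3); the reflection formula removes Γ(2/3).
  have h := two_mul_sum_betaIntegral_eq 0 (s := 2 / 3) (by norm_num) (by norm_num)
  have h' := sum_choose_mul_betaIntegral 1 (u := 1 / 3) (v := 1 / 3) (by norm_num) (by norm_num)
  have hG := Real.Gamma_mul_Gamma_one_sub (1 / 3)
  have hsin : Real.sin (Real.pi * (1 / 3)) = √3 / 2 := by
    rw [mul_one_div, Real.sin_pi_div_three]
  rw [hsin] at hG
  have hB : Complex.betaIntegral (1 / 3) (1 / 3) =
      ((Real.Gamma (1 / 3) ^ 3 * √3 / (2 * Real.pi) : ℝ) : ℂ) := by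
    rw [Complex.betaIntegral_eq_Gamma_mul_div _ _ (by norm_num) (by norm_num)]
    have e1 : Complex.Gamma (1 / 3) = ((Real.Gamma (1 / 3) : ℝ) : ℂ) := by
      rw [← Complex.Gamma_ofReal]
      norm_num
    have e2 : Complex.Gamma (1 / 3 + 1 / 3) = ((Real.Gamma (1 - 1 / 3) : ℝ) : ℂ) := by
      rw [← Complex.Gamma_ofReal]
      norm_num
    rw [e1, e2, ← Complex.ofReal_mul, ← Complex.ofReal_div]
    congr 1
    have p1 : 0 < Real.Gamma (1 / 3) := Real.Gamma_pos_of_pos (by norm_num)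
    have p2 : 0 < Real.Gamma (1 - 1 / 3) := Real.Gamma_pos_of_pos (by norm_num)
    have p3 := Real.pi_pos
    have p4 : 0 < √(3 : ℝ) := Real.sqrt_pos.2 (by norm_num)
    rw [eq_div_iff (by positivity)] at hG
    rw [div_eq_div_iff p2.ne' (by positivity)]
    linear_combination (-2 : ℝ) * Real.Gamma (1 / 3) ^ 2 * hG
  rw [← hB, gammaFactor, ← h, ← h']
  simp only [mul_zero, zero_add, Finset.sum_range_succ, Finset.range_zero, Finset.sum_empty,
    Nat.choose_zero_right, Nat.choose_self, Nat.cast_one, one_mul, Nat.cast_zero, add_zero,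
    Nat.sub_zero, Nat.sub_self]
  rw [show (2 * (2 / 3) - 1 : ℂ) = 1 / 3 by norm_num, show (1 - 2 / 3 : ℂ) = 1 / 3 by norm_num,
    Complex.betaIntegral_symm (1 / 3 + 1) (1 / 3)]
  ring

theorem hasSimplePoleWithResidue_two_thirds :
    HasSimplePoleWithResidue omegaContinuation (2 / 3)
      ((Real.Gamma (1 / 3) ^ 3 / (2 * Real.pi * Real.sqrt 3) : ℝ) : ℂ) := by
  have hmem : ((2 / 3 : ℂ)).re ∈ Ioo ((1 - (0 : ℕ) : ℝ) / 3) 1 := by norm_num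
  have hG := Real.Gamma_pos_of_pos (show (0 : ℝ) < 1 / 3 by norm_num)
  have hgf : AnalyticAt ℂ gammaFactor (2 / 3) := analyticAt_gammaFactor hmem.2 fun k h => by
    have := congrArg Complex.re h
    simp at this
    linarith [(Nat.cast_nonneg k : (0 : ℝ) ≤ k)]
  have hz : AnalyticAt ℂ (fun s : ℂ => riemannZeta₁ (3 * s - 1)) (2 / 3) :=
    (differentiable_riemannZeta₁.analyticAt _).fun_comp (f := fun s => 3 * s - 1) (by fun_prop)
  have h3 : √(3 : ℝ) * √3 = 3 := Real.mul_self_sqrt (by norm_num)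
  have h3' : 0 < √(3 : ℝ) := Real.sqrt_pos.2 (by norm_num)
  -- This uses (s - 2/3) ζ(3s-1) = ζ₁(3s-1)/3, and ζ₁(1) = 1.
  refine hasSimplePoleWithResidue_of_div (f := fun s => 1 / 3 * riemannZeta₁ (3 * s - 1) *
    (gammaFactor s - 2 * betaTail 0 s) + (s - 2 / 3) * omegaRemainder 0 s) ?_ ?_ ?_ ?_
  · exact ((analyticAt_const.mul hz).mul (hgf.sub
      (analyticAt_const.mul (analyticAt_betaTail hmem)))).add
      ((analyticAt_id.sub analyticAt_const).mul (analyticAt_omegaRemainder hmem))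
  · rw [gammaFactor_sub_betaTail_two_thirds, show (3 * (2 / 3) - 1 : ℂ) = 1 by norm_num,
      riemannZeta₁_one, sub_self, zero_mul, add_zero]
    have : (1 / 3 : ℝ) * (Real.Gamma (1 / 3) ^ 3 * √3 / (2 * Real.pi)) =
        Real.Gamma (1 / 3) ^ 3 / (2 * Real.pi * √3) := by
      have := Real.pi_pos
      field_simp
      linear_combination h3
    rw [← this]
    push_cast
    ring
  · have := Real.pi_pos
    exact_mod_cast (by positivity :
      Real.Gamma (1 / 3) ^ 3 / (2 * Real.pi * Real.sqrt 3) ≠ 0)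
  · filter_upwards [eventually_omegaContinuation_eq hmem] with w hw
    have hne : w - 2 / 3 ≠ 0 := sub_ne_zero.2 hw.1
    rw [hw.2, omegaStrip, ← riemannZeta_three_mul_sub_one hw.1, eq_div_iff hne]
    ring

/-- For k ≥ 1 the functional equation passes to (1+6k)/2, where ζ has no zero; the cosine factor
vanishes only at odd integers, and (1+6k)/2 is not an integer. -/
theorem riemannZeta_one_sub_six_mul_div_two_ne_zero (k : ℕ) :
    riemannZeta ((1 - 6 * (k : ℂ)) / 2) ≠ 0 := by
  rcases Nat.eq_zero_or_pos k with rfl | hk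
  · simpa using riemannZeta_one_half_ne_zero
  · have hk1 : (1 : ℝ) ≤ k := by exact_mod_cast hk
    set s : ℂ := (1 + 6 * (k : ℂ)) / 2 with hs
    have hre : s.re = (1 + 6 * (k : ℝ)) / 2 := by
      have : s = (((1 + 6 * (k : ℝ)) / 2 : ℝ) : ℂ) := by
        rw [hs]
        push_cast
        ring
      rw [this, Complex.ofReal_re]
    have e : (1 - 6 * (k : ℂ)) / 2 = 1 - s := by
      rw [hs]
      ring
    have hs0 : ∀ n : ℕ, s ≠ -n := fun n h => by
      have := congrArg Complex.re h
      rw [hre, Complex.neg_re, Complex.natCast_re] at this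
      linarith [(Nat.cast_nonneg n : (0 : ℝ) ≤ n)]
    have hs1 : s ≠ 1 := fun h => by
      have := congrArg Complex.re h
      rw [hre, Complex.one_re] at this
      linarith
    rw [e, riemannZeta_one_sub hs0 hs1]
    have hpi : (Real.pi : ℂ) ≠ 0 := by exact_mod_cast Real.pi_pos.ne'
    refine mul_ne_zero (mul_ne_zero (mul_ne_zero (mul_ne_zero two_ne_zero ?_)
      (Complex.Gamma_ne_zero hs0)) ?_) (riemannZeta_ne_zero_of_one_le_re (by rw [hre]; linarith))
    · exact fun h => mul_ne_zero two_ne_zero hpi ((Complex.cpow_eq_zero_iff _ _).1 h).1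
    · rw [Ne, Complex.cos_eq_zero_iff]
      rintro ⟨n, hn⟩
      have h1 : s = 2 * n + 1 := by
        have h2 : (Real.pi : ℂ) * s = Real.pi * (2 * n + 1) := by linear_combination 2 * hn
        exact mul_left_cancel₀ hpi h2
      have h2 : (1 + 6 * (k : ℤ) : ℂ) = 2 * (2 * n + 1) := by
        rw [← h1, hs]
        push_cast
        ring
      have h3 : (1 + 6 * (k : ℤ)) = 2 * (2 * n + 1) := by exact_mod_cast h2
      omega

theorem prod_range_sub_self (k : ℕ) :
    ∏ i ∈ Finset.range k, ((i : ℂ) - k) = (-1) ^ k * k.factorial := by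
  rw [← Finset.prod_range_reflect, ← Finset.prod_range_add_one_eq_factorial]
  push_cast
  have : ((-1 : ℂ)) ^ k = ∏ _i ∈ Finset.range k, (-1 : ℂ) := by simp
  rw [this, ← Finset.prod_mul_distrib]
  refine Finset.prod_congr rfl fun i hi => ?_
  have hi := Finset.mem_range.1 hi
  rw [show k - 1 - i = k - (i + 1) by omega, Nat.cast_sub (by omega)]
  push_cast
  ring

/-- Γ(s-1/2) is Γ(s-1/2+k+1) divided by the product of s - 1/2 + i for i ≤ k. The factor i = k is s
- z₀, and the others have product (-1)^k k! at z₀. -/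
theorem hasSimplePoleWithResidue_one_half_sub (k : ℕ) :
    HasSimplePoleWithResidue omegaContinuation (1 / 2 - (k : ℂ))
      ((-1) ^ k * (1 / 2 ^ (4 * k)) * (Nat.choose (2 * k) k : ℂ) *
        riemannZeta ((1 - 6 * (k : ℂ)) / 2)) := by
  set z₀ : ℂ := 1 / 2 - (k : ℂ) with hz₀
  have hk0 : (0 : ℝ) ≤ k := by positivity
  have hzre : z₀.re = 1 / 2 - k := by
    rw [hz₀]
    simp
  -- The choice r = 3k puts the left edge at 1/3 - k, below 1/2 - k.
  have hmem : z₀.re ∈ Ioo ((1 - (3 * k : ℕ) : ℝ) / 3) 1 := by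
    rw [hzre]
    push_cast
    constructor <;> linarith
  have hz23 : z₀ ≠ 2 / 3 := fun h => by
    have := congrArg Complex.re h
    rw [hzre] at this
    norm_num at this
    linarith
  have hfac : (k.factorial : ℂ) ≠ 0 := by exact_mod_cast k.factorial_ne_zero
  have hprod : ∏ i ∈ Finset.range k, (z₀ - 1 / 2 + i) = (-1) ^ k * k.factorial := by
    rw [← prod_range_sub_self]
    refine Finset.prod_congr rfl fun i _ => ?_
    rw [hz₀]
    ring
  have hprod0 : ∏ i ∈ Finset.range k, (z₀ - 1 / 2 + i) ≠ 0 := by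
    rw [hprod]
    exact mul_ne_zero (pow_ne_zero _ (by norm_num)) hfac
  have hGam : AnalyticAt ℂ (fun s => Complex.Gamma (s - 1 / 2 + (k + 1 : ℕ))) z₀ := by
    have h : AnalyticAt ℂ Complex.Gamma (z₀ - 1 / 2 + (k + 1 : ℕ)) := by
      refine analyticAt_Gamma_of_re_pos ?_
      rw [hz₀]
      simp
    exact h.fun_comp (f := fun s : ℂ => s - 1 / 2 + (k + 1 : ℕ)) (by fun_prop)
  have hP : AnalyticAt ℂ (fun s : ℂ => ∏ i ∈ Finset.range k, (s - 1 / 2 + i)) z₀ := by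
    have : Differentiable ℂ (fun s : ℂ => ∏ i ∈ Finset.range k, (s - 1 / 2 + i)) := by fun_prop
    exact this.analyticAt z₀
  refine hasSimplePoleWithResidue_of_div (f := fun s => riemannZeta (3 * s - 1) *
    (2 ^ (2 * s - 1) * (Complex.Gamma (s - 1 / 2 + (k + 1 : ℕ)) /
      ∏ i ∈ Finset.range k, (s - 1 / 2 + i)) * Complex.Gamma (1 - s) / √Real.pi -
      (s - z₀) * (2 * betaTail (3 * k) s)) + (s - z₀) * omegaRemainder (3 * k) s) ?_ ?_ ?_ ?_
  · exact ((analyticAt_riemannZeta_three_mul_sub_one hz23).mul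
      (((((analyticAt_two_cpow z₀).mul (hGam.div hP hprod0)).mul
        (analyticAt_Gamma_one_sub hmem.2)).div analyticAt_const sqrt_pi_ne_zero).sub
        ((analyticAt_id.sub analyticAt_const).mul
          (analyticAt_const.mul (analyticAt_betaTail hmem))))).add
      ((analyticAt_id.sub analyticAt_const).mul (analyticAt_omegaRemainder hmem))
  · rw [sub_self, zero_mul, zero_mul, sub_zero, add_zero, hprod]
    have e1 : 3 * z₀ - 1 = (1 - 6 * (k : ℂ)) / 2 := by
      rw [hz₀]
      ring
    have e2 : z₀ - 1 / 2 + (k + 1 : ℕ) = 1 := by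
      rw [hz₀]
      push_cast
      ring
    have e3 : 1 - z₀ = k + 1 / 2 := by
      rw [hz₀]
      ring
    have e4 : (2 : ℂ) ^ (2 * z₀ - 1) = (2 ^ (2 * k))⁻¹ := by
      rw [← Complex.cpow_natCast, ← Complex.cpow_neg, hz₀]
      congr 1
      push_cast
      ring
    rw [e1, e2, e3, e4, Complex.Gamma_one]
    -- Duplication gives Γ(k+1/2) = (2k)! √π / (4^k k!). With 2^(2z₀-1) = 4^(-k) this produces
    -- 2^(-4k) and the central binomial coefficient.
    have hdup := Complex.Gamma_mul_Gamma_add_half (k + 1 / 2)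
    have e5 : (k : ℂ) + 1 / 2 + 1 / 2 = k + 1 := by ring
    have e6 : 2 * ((k : ℂ) + 1 / 2) = ((2 * k : ℕ) : ℂ) + 1 := by
      push_cast
      ring
    have e7 : (2 : ℂ) ^ (1 - (((2 * k : ℕ) : ℂ) + 1)) = (2 ^ (2 * k))⁻¹ := by
      rw [← Complex.cpow_natCast, ← Complex.cpow_neg]
      congr 1
      ring
    rw [e5, e6, e7, Complex.Gamma_nat_eq_factorial, Complex.Gamma_nat_eq_factorial] at hdup
    have hchoose : ((2 * k).choose k : ℂ) = (2 * k).factorial / (k.factorial * k.factorial) := by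
      rw [Nat.cast_choose ℂ (by omega : k ≤ 2 * k), show 2 * k - k = k by omega]
    have hGk : Complex.Gamma (k + 1 / 2) =
        (2 * k).factorial * (2 ^ (2 * k))⁻¹ * √Real.pi / k.factorial := by
      rw [eq_div_iff hfac, hdup]
    have hsgn : ((-1 : ℂ) ^ k) * (-1) ^ k = 1 := by
      rw [← mul_pow]
      norm_num
    have hsgn' : ((-1 : ℂ) ^ k)⁻¹ = (-1) ^ k := inv_eq_of_mul_eq_one_left hsgn
    have hsq := sqrt_pi_ne_zero
    have h2k : (2 : ℂ) ^ (4 * k) = 2 ^ (2 * k) * 2 ^ (2 * k) := by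
      rw [← pow_add]
      congr 1
      ring
    rw [hGk, hchoose, h2k, one_div ((-1 : ℂ) ^ k * _), mul_inv, hsgn']
    field_simp
  · refine mul_ne_zero (mul_ne_zero (mul_ne_zero (pow_ne_zero _ (by norm_num))
      (one_div_ne_zero (pow_ne_zero _ two_ne_zero))) ?_)
      (riemannZeta_one_sub_six_mul_div_two_ne_zero k)
    exact_mod_cast (Nat.choose_pos (by omega)).ne'
  · filter_upwards [eventually_omegaContinuation_eq hmem, self_mem_nhdsWithin,
      nhdsWithin_le_nhds (Metric.ball_mem_nhds z₀ one_pos)] with w hw hne hball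
    have hne' : w - z₀ ≠ 0 := sub_ne_zero.2 hne
    have hshift : ∀ i : ℕ, w - 1 / 2 + i = (w - z₀) + ((i : ℂ) - k) := fun i => by
      rw [hz₀]
      ring
    -- The zeros of these factors lie at integer distance at least 1 from z₀, hence outside the unit
    -- ball.
    have hlt : ∀ i < k, w - 1 / 2 + i ≠ 0 := fun i hi h => by
      rw [hshift] at h
      rw [Metric.mem_ball, dist_eq_norm] at hball
      have h1 : w - z₀ = ((k - i : ℕ) : ℂ) := by
        rw [Nat.cast_sub hi.le]
        linear_combination h
      rw [h1, Complex.norm_natCast] at hball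
      have : k - i < 1 := by exact_mod_cast hball
      omega
    have hle : ∀ i < k + 1, w - 1 / 2 + i ≠ 0 := fun i hi => by
      rcases Nat.lt_succ_iff_lt_or_eq.1 hi with h | rfl
      · exact hlt i h
      · rw [hshift, sub_self, add_zero]
        exact hne'
    have hG := prod_mul_Gamma (k + 1) hle
    rw [Finset.prod_range_succ, hshift k, sub_self, add_zero] at hG
    have hPw : ∏ i ∈ Finset.range k, (w - 1 / 2 + i) ≠ 0 :=
      Finset.prod_ne_zero_iff.2 fun i hi => hlt i (Finset.mem_range.1 hi)
    have hGw : Complex.Gamma (w - 1 / 2 + (k + 1 : ℕ)) / ∏ i ∈ Finset.range k, (w - 1 / 2 + i) =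
        (w - z₀) * Complex.Gamma (w - 1 / 2) := by
      rw [div_eq_iff hPw, ← hG]
      ring
    rw [hw.2, omegaStrip, gammaFactor, hGw, eq_div_iff hne']
    ring

/-! ### Growth of the continuation and conclusion -/

theorem PolyGrowth.union {f : ℂ → ℂ} {S T : Set ℂ} (hS : PolyGrowth f S) (hT : PolyGrowth f T) :
    PolyGrowth f (S ∪ T) := by
  obtain ⟨C, M, hC, H⟩ := hS
  obtain ⟨C', M', hC', H'⟩ := hT
  refine ⟨max C C', max M M', hC.trans (le_max_left _ _), fun s hs ht => ?_⟩
  rcases hs with hs | hs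
  · exact (H s hs ht).trans (mul_le_mul (le_max_left _ _) (pow_le_pow_right₀ ht (le_max_left _ _))
      (by positivity) (hC.trans (le_max_left _ _)))
  · exact (H' s hs ht).trans (mul_le_mul (le_max_right _ _)
      (pow_le_pow_right₀ ht (le_max_right _ _)) (by positivity) (hC.trans (le_max_left _ _)))

/-- The cut at Re s = 9/10 lies between 2/3 and 1: to its right the series is bounded, to its left a
single strip formula applies. -/
theorem polyGrowth_omegaContinuation (a b : ℝ) :
    PolyGrowth omegaContinuation (Complex.re ⁻¹' Icc a b) := by
  have hL : PolyGrowth omegaContinuation (Complex.re ⁻¹' Icc a (9 / 10)) := by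
    obtain ⟨r, hr⟩ := exists_strip_index a
    have hz : PolyGrowth (fun s => riemannZeta (3 * s - 1)) (Complex.re ⁻¹' Icc a (9 / 10)) := by
      have h := (polyGrowth_riemannZeta (3 * a - 1) (3 * (9 / 10) - 1)).comp_affine (m := 3)
        (S := Complex.re ⁻¹' Icc a (9 / 10)) (by norm_num) (-1) fun s hs => by
          simp only [mem_preimage, Complex.add_re, Complex.ofReal_re]
          have : (((3 : ℕ) : ℂ) * s).re = 3 * s.re := by simp
          rw [this]
          exact ⟨by linarith [hs.1], by linarith [hs.2]⟩
      simpa [sub_eq_add_neg] using h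
    have h1 : PolyGrowth (omegaStrip r) (Complex.re ⁻¹' Icc a (9 / 10)) :=
      (hz.mul ((polyGrowth_gammaFactor a (by norm_num)).sub
        ((PolyGrowth.const 2).mul (polyGrowth_betaTail hr (by norm_num))))).add
        (polyGrowth_omegaRemainder hr (by norm_num))
    refine h1.congr fun s hs ht => omegaContinuation_eq_omegaStrip
      ⟨hr.trans_le hs.1, hs.2.trans_lt (by norm_num)⟩ ?_
    rintro rfl
    norm_num at ht
  have hR : PolyGrowth omegaContinuation (Complex.re ⁻¹' Ici (9 / 10)) := by
    obtain ⟨C, hC⟩ := exists_norm_omegaSeries_le (c := 9 / 10) (by norm_num)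
    refine PolyGrowth.of_bounded (C := C) fun s hs _ => ?_
    have hs : 9 / 10 ≤ s.re := hs
    rw [omegaContinuation_of_lt (by linarith)]
    exact hC s hs
  refine (hL.union hR).mono fun s hs => ?_
  rcases le_total s.re (9 / 10) with h | h
  · exact Or.inl ⟨hs.1, h⟩
  · exact Or.inr h

theorem meromorphic_omegaContinuation : Meromorphic omegaContinuation := by
  intro s
  by_cases h1 : s = 2 / 3
  · rw [h1]
    exact hasSimplePoleWithResidue_two_thirds.meromorphicAt
  · by_cases h2 : ∃ k : ℕ, s = 1 / 2 - (k : ℂ)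
    · obtain ⟨k, rfl⟩ := h2
      exact (hasSimplePoleWithResidue_one_half_sub k).meromorphicAt
    · push Not at h2
      exact (analyticAt_omegaContinuation h1 h2).meromorphicAt

theorem theorem2 :
    -- the series converges precisely for `Re s > 2/3`
    (∀ s : ℂ, Summable (omegaTerm s) ↔ 2 / 3 < s.re) ∧
    -- and is holomorphic there
    DifferentiableOn ℂ omegaSeries {s : ℂ | 2 / 3 < s.re} ∧
    -- meromorphic continuation `W` to the whole plane
    ∃ W : ℂ → ℂ,
      Meromorphic W ∧
      (∀ s : ℂ, 2 / 3 < s.re → W s = omegaSeries s) ∧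
      -- its poles and residues
      HasSimplePoleWithResidue W (2 / 3)
        ((Real.Gamma (1 / 3) ^ 3 / (2 * Real.pi * Real.sqrt 3) : ℝ) : ℂ) ∧
      (∀ k : ℕ, HasSimplePoleWithResidue W (1 / 2 - (k : ℂ))
        ((-1) ^ k * (1 / 2 ^ (4 * k)) * (Nat.choose (2 * k) k : ℂ) *
          riemannZeta ((1 - 6 * (k : ℂ)) / 2))) ∧
      (∀ s : ℂ, s ≠ 2 / 3 → (∀ k : ℕ, s ≠ 1 / 2 - (k : ℂ)) → AnalyticAt ℂ W s) ∧
      -- polynomial growth, uniformly on vertical strips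
      (∀ a b : ℝ, ∃ C M : ℝ, 0 < C ∧ 0 < M ∧
        ∀ σ ∈ Set.Icc a b, ∀ t : ℝ, 1 ≤ |t| →
          ‖W ((σ : ℂ) + (t : ℂ) * Complex.I)‖ ≤ C * |t| ^ M) := by

  refine ⟨summable_omegaTerm_iff, differentiableOn_omegaSeries, omegaContinuation,
    meromorphic_omegaContinuation, fun s hs => omegaContinuation_of_lt hs,
    hasSimplePoleWithResidue_two_thirds, hasSimplePoleWithResidue_one_half_sub,
    fun s => analyticAt_omegaContinuation, fun a b => ?_⟩
  obtain ⟨C, M, hC, h⟩ := polyGrowth_omegaContinuation a b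
  -- Both constants must be positive, whereas C and M may be 0.
  refine ⟨C + 1, M + 1, by positivity, by positivity, fun σ hσ t ht => ?_⟩
  have h1 := h (σ + t * Complex.I) (by simpa using hσ) (by simpa using ht)
  have him : ((σ : ℂ) + (t : ℂ) * Complex.I).im = t := by simp
  rw [him] at h1
  refine h1.trans ?_
  have e : |t| ^ ((M : ℝ) + 1) = |t| ^ (M + 1) := by exact_mod_cast Real.rpow_natCast |t| (M + 1)
  rw [e]
  exact mul_le_mul (by linarith) (pow_le_pow_right₀ ht (by omega)) (by positivity) (by positivity)
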